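/- Let $k$ be an algebraically closed field of characteristic $0$, let $G$ be a reductive algebraic group over $k$, and let $W$ be an affine $G$-scheme of finite type with coordinate ring $P=k[W]$. Let $X\subset W$ be a $G$-stable closed subscheme with ideal $I\subset P$, such that $\dim_k \mathrm{Hom}^G(M,P/I)<\infty$ for every irreducible rational $G$-module $M$. Fix a $G$-equivariant presentation of $P/I$, that is, finite-dimensional $G$-submodules $N_1\subset P$ and $N_2\subset P\otimes_k N_1$ such that the sequence $$P\otimes N_2\xrightarrow{\,v_0\,}P\otimes N_1\xrightarrow{\,u_0\,}P\to P/I\to 0,\qquad v_0(1\otimes r)=r,\quad u_0(1\otimes f)=f,$$ is exact. Let $$\mu^G:\mathrm{Hom}^G_P(P\otimes N_1,P)\oplus\mathrm{Hom}^G_P(P\otimes N_2,P\otimes N_1)\to\mathrm{Hom}^G_P(P\otimes N_2,P),\qquad (C,D)\mapsto C\,v_0+u_0\,D,$$ and $N^G:=\mathrm{Coker}(\mu^G)$ (after a choice of bases of $N_1,N_2$ all these maps are $G$-equivariant matrices over $P$, and $u_0$, $v_0$ are given by matrices $U_0$, $V_0$). Let $\mathrm{Ext}^{1,G}_P(I,P/I)$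 be the first Ext group in the abelian category of $(P,G)$-modules, i.e. $P$-modules with a compatible rational action of $G$. Put $K=\mathrm{Ker}(u_0)=\mathrm{Im}(v_0)$ and let $\delta:\mathrm{Hom}^G_P(K,P/I)\to\mathrm{Ext}^{1,G}_P(I,P/I)$ be the connecting map of $0\to K\to P\otimes N_1\to I\to0$. For an Artinian local $k$-algebra $A$ with residue field $k$ and maximal ideal $\mathfrak m_A$, write $P_A=P\otimes A$ (with trivial action of $G$ on $A$), and let $D(A)$ be the set of $G$-stable ideals $Z\subset P_A$ such that $P_A/Z$ is flat over $A$ and $Z$ has image $I$ in $P_A/\mathfrak m_AP_A=P$; this is the functor of $G$-stable deformations of $X$ inside $W$. A small extension is an exact sequence $0\to J\to A'\to A\to 0$ given by a surjection of such algebras with $\mathfrak m_{A'}J=0$. An obstruction theory for $D$ with obstruction space $V$ is a finite-dimensional vector space $V$ together with, for each small extension, a map $\mathrm{ob}:D(A)\to J\otimes V$ such that $\mathrm{ob}(\lambda)=0$ if and only if $\lambda$ lies in the image of $D(A')\to D(A)$, and such that for every morphism from a small extension $0\to J_1\to A'\to A\to0$ to a small extension $0\to J_2\to B'\to B\to0$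 the maps $\mathrm{ob}_1$, $\mathrm{ob}_2$ are compatible with the induced maps $D(A)\to D(B)$ and $J_1\otimes V\to J_2\otimes V$. Then $\mathrm{Ext}^{1,G}_P(I,P/I)$ and $N^G$ are finite-dimensional vector spaces, and there is an injective linear map $$\iota:\mathrm{Ext}^{1,G}_P(I,P/I)\hookrightarrow N^G,$$ such that $\iota(\delta(\psi))$ is the class of $C$ whenever $\psi\in\mathrm{Hom}^G_P(K,P/I)$ and $C\in\mathrm{Hom}^G_P(P\otimes N_2,P)$ is a lift of $\psi\circ v_0:P\otimes N_2\to P/I$. Moreover, there are well-defined maps $\mathrm{ob}:D(A)\to J\otimes\mathrm{Ext}^{1,G}_P(I,P/I)$, one for each small extension, given as follows. For $Z\in D(A)$ choose an exact sequence of $(P_A,G)$-modules $P_A\otimes N_2\xrightarrow{v}P_A\otimes N_1\xrightarrow{u}P_A\to P_A/Z\to0$ which reduces modulo $\mathfrak m_A$ to the presentation above, and $G$-equivariant $P_{A'}$-linear lifts $u',v'$ of $u,v$ to $A'$; then $u'v'$ maps $N_2$ to $P\otimes J$, and modulo $I$ it has the form $\bigl(\sum_i j_i\otimes\psi_i\bigr)\circ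 v_0$ with $j_i\in J$ and $\psi_i\in\mathrm{Hom}^G_P(K,P/I)$; and $\mathrm{ob}(Z)=\sum_i j_i\otimes\delta(\psi_i)$, independently of all choices. The composed maps $(\mathrm{id}_J\otimes\iota)\circ\mathrm{ob}:D(A)\to J\otimes N^G$ form an obstruction theory for $D$ with obstruction space $N^G$. -/

import Mathlib

open CategoryTheory CategoryTheory.Limits TensorProduct

universe u v

/-- The structure of an affine algebraic group on an abstract group `G` over `k`: a finitely
generated algebra of `k`-valued functions on `G` (the regular functions), whose `k`-algebra
homomorphisms to `k` are exactly the evaluations at the points of `G`, such that multiplication and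
inversion are morphisms. -/
structure AlgGroup (k : Type u) (G : Type u) [Field k] [Group G] where
  /-- the algebra `k[G]` of regular functions -/
  regular : Subalgebra k (G → k)
  finiteType : Algebra.FiniteType k regular
  points : Function.Bijective (fun g : G => ((Pi.evalAlgHom k (fun _ : G => k) g).comp regular.val))
  mul_regular : ∀ f ∈ regular, (fun p : G × G => f (p.1 * p.2)) ∈
    Submodule.span k {F : G × G → k | ∃ a ∈ regular, ∃ b ∈ regular, F = fun p => a p.1 * b p.2}
  inv_regular : ∀ f ∈ regular, (fun g : G => f g⁻¹) ∈ regular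

namespace AlgGroup

variable {k G : Type u} [Field k] [Group G] (𝒢 : AlgGroup k G)

/-- The regular maps from `G` to a vector space `V`, i.e. the image of `k[G] ⊗ V` in `G → V`. -/
def regularMaps (V : Type u) [AddCommGroup V] [Module k V] : Submodule k (G → V) :=
  Submodule.span k {F | ∃ f ∈ 𝒢.regular, ∃ w : V, F = fun g => f g • w}

/-- A representation is rational if all its orbit maps `g ↦ g v` are regular. -/
def IsRational {V : Type u} [AddCommGroup V] [Module k V] (ρ : Representation k G V) : Prop :=
  ∀ v : V, (fun g => ρ g v) ∈ 𝒢.regularMaps V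

/-- Reductivity (in characteristic zero): every finite-dimensional rational representation is
completely reducible. -/
def IsReductive : Prop :=
  ∀ (V : Type u) [AddCommGroup V] [Module k V] [FiniteDimensional k V]
    (ρ : Representation k G V), 𝒢.IsRational ρ → ρ.IsSemisimpleRepresentation

variable {𝒢}
variable {V W X : Type u} [AddCommGroup V] [Module k V] [AddCommGroup W] [Module k W]
  [AddCommGroup X] [Module k X]

lemma regularMaps_comp (φ : V →ₗ[k] W) {F : G → V} (hF : F ∈ 𝒢.regularMaps V) :
    (fun g => φ (F g)) ∈ 𝒢.regularMaps W := by
  have : 𝒢.regularMaps V ≤ (𝒢.regularMaps W).comap (φ.compLeft G) := by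
    refine Submodule.span_le.2 ?_
    rintro _ ⟨f, hf, w, rfl⟩
    exact Submodule.subset_span ⟨f, hf, φ w, by ext g; simp⟩
  exact this hF

lemma IsRational.of_injective {ρ : Representation k G V} {σ : Representation k G W}
    (φ : V →ₗ[k] W) (hφ : Function.Injective φ) (h : ∀ g v, φ (ρ g v) = σ g (φ v))
    (hσ : 𝒢.IsRational σ) : 𝒢.IsRational ρ := by
  intro v
  obtain ⟨ψ, hψ⟩ := φ.exists_leftInverse_of_injective (LinearMap.ker_eq_bot.2 hφ)
  convert regularMaps_comp ψ (hσ (φ v)) using 2 with g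
  rw [← h]
  exact (LinearMap.congr_fun hψ (ρ g v)).symm

lemma IsRational.of_surjective {ρ : Representation k G V} {σ : Representation k G W}
    (φ : V →ₗ[k] W) (hφ : Function.Surjective φ) (h : ∀ g v, φ (ρ g v) = σ g (φ v))
    (hρ : 𝒢.IsRational ρ) : 𝒢.IsRational σ := by
  intro w
  obtain ⟨v, rfl⟩ := hφ w
  simpa only [h] using regularMaps_comp φ (hρ v)

lemma IsRational.trivial : 𝒢.IsRational (Representation.trivial k G V) := fun v =>
  Submodule.subset_span ⟨1, 𝒢.regular.one_mem, v, by ext; simp⟩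

lemma IsRational.prod {ρ : Representation k G V} {σ : Representation k G W}
    (hρ : 𝒢.IsRational ρ) (hσ : 𝒢.IsRational σ) : 𝒢.IsRational (ρ.prod σ) := by
  rintro ⟨v, w⟩
  convert add_mem (regularMaps_comp (LinearMap.inl k V W) (hρ v))
    (regularMaps_comp (LinearMap.inr k V W) (hσ w)) using 1
  ext g <;> simp

lemma regularMaps_tmul {F : G → V} {H : G → W} (hF : F ∈ 𝒢.regularMaps V)
    (hH : H ∈ 𝒢.regularMaps W) : (fun g => F g ⊗ₜ[k] H g) ∈ 𝒢.regularMaps (V ⊗[k] W) := by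
  induction hF using Submodule.span_induction with
  | mem F hF =>
    obtain ⟨a, ha, x, rfl⟩ := hF
    induction hH using Submodule.span_induction with
    | mem H hH =>
      obtain ⟨b, hb, y, rfl⟩ := hH
      exact Submodule.subset_span ⟨a * b, mul_mem ha hb, x ⊗ₜ y, by
        ext g; simp [TensorProduct.tmul_smul, TensorProduct.smul_tmul', smul_smul, mul_comm]⟩
    | zero => convert zero_mem (𝒢.regularMaps (V ⊗[k] W)) using 1; ext g; simp
    | add H H' _ _ h h' =>
      convert add_mem h h' using 1; ext g; simp [TensorProduct.tmul_add]
    | smul c H _ h =>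
      convert Submodule.smul_mem _ c h using 1; ext g; simp
  | zero => convert zero_mem (𝒢.regularMaps (V ⊗[k] W)) using 1; ext g; simp
  | add F F' _ _ h h' =>
    convert add_mem h h' using 1; ext g; simp [TensorProduct.add_tmul]
  | smul c F _ h =>
    convert Submodule.smul_mem _ c h using 1; ext g; simp [TensorProduct.smul_tmul']

lemma IsRational.tprod {ρ : Representation k G V} {σ : Representation k G W}
    (hρ : 𝒢.IsRational ρ) (hσ : 𝒢.IsRational σ) : 𝒢.IsRational (ρ.tprod σ) := by
  intro t
  induction t using TensorProduct.induction_on with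
  | zero => convert zero_mem (𝒢.regularMaps (V ⊗[k] W)) using 1; ext g; simp
  | tmul v w => simpa using regularMaps_tmul (hρ v) (hσ w)
  | add x y hx hy => convert add_mem hx hy using 1; ext g; simp

end AlgGroup

/-- A commutative `k`-algebra with a rational action of the algebraic group by `k`-algebra
automorphisms: the coordinate ring of an affine `G`-scheme. -/
structure GAlg {k G : Type u} [Field k] [Group G] (𝒢 : AlgGroup k G) where
  carrier : Type u
  [commRing : CommRing carrier]
  [algebra : Algebra k carrier]
  act : G →* (carrier ≃ₐ[k] carrier)
  rational : 𝒢.IsRational ((AlgEquiv.toLinearMapHom k carrier).comp act)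

namespace GAlg

variable {k G : Type u} [Field k] [Group G] {𝒢 : AlgGroup k G}

attribute [instance] GAlg.commRing GAlg.algebra

instance : CoeSort (GAlg 𝒢) (Type u) := ⟨GAlg.carrier⟩

/-- The underlying representation of a `G`-algebra. -/
def rep (P : GAlg 𝒢) : Representation k G P := (AlgEquiv.toLinearMapHom k P).comp P.act

@[simp] lemma rep_apply (P : GAlg 𝒢) (g : G) (p : P) : P.rep g p = P.act g p := rfl

end GAlg

section Modules

variable {k G : Type u} [Field k] [Group G] {𝒢 : AlgGroup k G}

/-- A (rational) `(P, G)`-module: a `P`-module with a rational `k`-linear action of `G` such that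
`g (p m) = (g p) (g m)`. -/
structure EqMod (P : GAlg 𝒢) where
  carrier : Type u
  [addCommGroup : AddCommGroup carrier]
  [moduleBase : Module k carrier]
  [module : Module P carrier]
  [tower : IsScalarTower k P carrier]
  ρ : Representation k G carrier
  semilinear : ∀ g (p : P) (m : carrier), ρ g (p • m) = P.act g p • ρ g m
  rational : 𝒢.IsRational ρ

namespace EqMod

attribute [instance] EqMod.addCommGroup EqMod.moduleBase EqMod.module EqMod.tower

variable {P : GAlg 𝒢}

instance : CoeSort (EqMod P) (Type u) := ⟨EqMod.carrier⟩

/-- The `k`-vector space `Hom_P^G(M, N)` of `P`-linear, `G`-equivariant maps. -/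
def equivariantHom (M N : EqMod P) : Submodule k (M →ₗ[P] N) where
  carrier := {f | ∀ g m, f (M.ρ g m) = N.ρ g (f m)}
  add_mem' := fun ha hb g m => by simp [ha g m, hb g m]
  zero_mem' := fun g m => by simp
  smul_mem' := fun c f hf g m => by simp [hf g m]

/-- The category of `(P, G)`-modules, with `Hom_P^G(M, N)` as morphisms. -/
instance : Category (EqMod P) where
  Hom M N := equivariantHom M N
  id M := ⟨LinearMap.id, fun _ _ => rfl⟩
  comp f g := ⟨g.1 ∘ₗ f.1, fun x m => by
    simp only [LinearMap.comp_apply]; rw [f.2, g.2]⟩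

/-- The linear map underlying a morphism of `(P, G)`-modules. -/
def lin {M N : EqMod P} (f : M ⟶ N) : M →ₗ[P] N := f.1

lemma lin_comm {M N : EqMod P} (f : M ⟶ N) (g : G) (m : M) :
    lin f (M.ρ g m) = N.ρ g (lin f m) := f.2 g m

/-- Constructor for morphisms. -/
def mkHom {M N : EqMod P} (f : M →ₗ[P] N) (h : ∀ g m, f (M.ρ g m) = N.ρ g (f m)) : M ⟶ N := ⟨f, h⟩

@[ext] lemma hom_ext {M N : EqMod P} {f g : M ⟶ N} (h : ∀ m, lin f m = lin g m) : f = g :=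
  Subtype.ext (LinearMap.ext h)

instance (M N : EqMod P) : AddCommGroup (M ⟶ N) :=
  inferInstanceAs (AddCommGroup (equivariantHom M N))

instance (M N : EqMod P) : Module k (M ⟶ N) :=
  inferInstanceAs (Module k (equivariantHom M N))

section simps
variable {M N L : EqMod P}
@[simp] lemma lin_mkHom (f : M →ₗ[P] N) (h) : lin (mkHom f h) = f := rfl
@[simp] lemma lin_id : lin (𝟙 M) = LinearMap.id := rfl
@[simp] lemma lin_comp (f : M ⟶ N) (g : N ⟶ L) : lin (f ≫ g) = lin g ∘ₗ lin f := rfl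
@[simp] lemma lin_add (f g : M ⟶ N) : lin (f + g) = lin f + lin g := rfl
@[simp] lemma lin_zero : lin (0 : M ⟶ N) = 0 := rfl
@[simp] lemma lin_smul (c : k) (f : M ⟶ N) : lin (c • f) = c • lin f := rfl
end simps

instance : Preadditive (EqMod P) where
  add_comp _ _ _ _ _ _ := by ext; simp
  comp_add _ _ _ _ _ _ := by ext; simp

@[simp] lemma lin_zero' {M N : EqMod P} : lin (0 : M ⟶ N) = 0 := rfl
@[simp] lemma lin_sub {M N : EqMod P} (f g : M ⟶ N) : lin (f - g) = lin f - lin g := rfl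

instance : Linear k (EqMod P) where
  homModule := inferInstance
  smul_comp _ _ _ _ _ _ := by ext; simp [LinearMap.map_smul_of_tower]
  comp_smul _ _ _ _ _ _ := by ext; simp

/-- A `G`-stable `P`-submodule as a `(P, G)`-module. -/
def sub (M : EqMod P) (N : Submodule P M) (h : ∀ g, ∀ m ∈ N, M.ρ g m ∈ N) : EqMod P where
  carrier := N
  tower := ⟨fun c p m => Subtype.ext (smul_assoc c p m.1)⟩
  ρ := (⟨N.restrictScalars k, h⟩ : Subrepresentation M.ρ).toRepresentation
  semilinear g p m := Subtype.ext (M.semilinear g p m)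
  rational := .of_injective (W := M) (N.subtype.restrictScalars k) Subtype.val_injective
    (fun _ _ => rfl) M.rational

/-- The inclusion of a `G`-stable submodule. -/
def subι (M : EqMod P) (N : Submodule P M) (h) : M.sub N h ⟶ M :=
  mkHom N.subtype fun _ _ => rfl

/-- The quotient by a `G`-stable `P`-submodule as a `(P, G)`-module. -/
noncomputable def quot (M : EqMod P) (N : Submodule P M) (h : ∀ g, ∀ m ∈ N, M.ρ g m ∈ N) :
    EqMod P where
  carrier := M ⧸ N
  ρ :=
    { toFun g := (Submodule.Quotient.restrictScalarsEquiv k N).conj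
        ((M.ρ.quotient (N.restrictScalars k) h) g)
      map_one' := by rw [map_one]; exact map_one (LinearEquiv.conjAlgEquiv k _)
      map_mul' := fun x y => by rw [map_mul]; exact map_mul (LinearEquiv.conjAlgEquiv k _) _ _ }
  semilinear g p m := by
    obtain ⟨m, rfl⟩ := N.mkQ_surjective m
    exact congrArg N.mkQ (M.semilinear g p m)
  rational := .of_surjective (V := M) (N.mkQ.restrictScalars k) N.mkQ_surjective
    (fun _ _ => rfl) M.rational

/-- The projection to the quotient by a `G`-stable submodule. -/
noncomputable def quotπ (M : EqMod P) (N : Submodule P M) (h) : M ⟶ M.quot N h :=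
  mkHom N.mkQ fun _ _ => rfl

/-- The direct sum of two `(P, G)`-modules. -/
noncomputable def prodObj (M N : EqMod P) : EqMod P where
  carrier := M × N
  ρ := M.ρ.prod N.ρ
  semilinear g p m := Prod.ext (M.semilinear g p m.1) (N.semilinear g p m.2)
  rational := M.rational.prod N.rational

/-- The zero `(P, G)`-module. -/
def zeroObj : EqMod P where
  carrier := PUnit
  ρ := 1
  semilinear _ _ _ := rfl
  rational := .trivial

instance : HasZeroObject (EqMod P) := ⟨zeroObj, by
  rw [IsZero.iff_id_eq_zero]; ext m; rfl⟩

instance (M N : EqMod P) : HasBinaryProduct M N :=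
  ⟨⟨⟨BinaryFan.mk (P := prodObj M N) (mkHom (LinearMap.fst P M N) fun _ _ => rfl)
      (mkHom (LinearMap.snd P M N) fun _ _ => rfl),
    BinaryFan.IsLimit.mk _
      (fun f g => mkHom (N := prodObj M N) (LinearMap.prod (lin f) (lin g))
        fun x m => Prod.ext (lin_comm f x m) (lin_comm g x m))
      (fun _ _ => rfl) (fun _ _ => rfl)
      (fun _ _ _ h₁ h₂ => by
        subst h₁ h₂; rfl)⟩⟩⟩

instance : HasFiniteProducts (EqMod P) :=
  haveI : HasBinaryProducts (EqMod P) := hasBinaryProducts_of_hasLimit_pair _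
  hasFiniteProducts_of_has_binary_and_terminal

section kernels
variable {M N : EqMod P} (f : M ⟶ N)

lemma ker_stable (g : G) (m : M) (hm : m ∈ LinearMap.ker (lin f)) :
    M.ρ g m ∈ LinearMap.ker (lin f) := by
  rw [LinearMap.mem_ker] at hm ⊢
  rw [lin_comm, hm, map_zero]

lemma range_stable (g : G) (n : N) (hn : n ∈ LinearMap.range (lin f)) :
    N.ρ g n ∈ LinearMap.range (lin f) := by
  obtain ⟨m, rfl⟩ := hn
  exact ⟨M.ρ g m, lin_comm f g m⟩

/-- The kernel of a morphism of `(P, G)`-modules. -/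
def kerObj : EqMod P := M.sub (LinearMap.ker (lin f)) (ker_stable f)

/-- The inclusion of the kernel. -/
def kerι : kerObj f ⟶ M := M.subι _ _

/-- The cokernel of a morphism of `(P, G)`-modules. -/
noncomputable def cokerObj : EqMod P := N.quot (LinearMap.range (lin f)) (range_stable f)

/-- The projection to the cokernel. -/
noncomputable def cokerπ : N ⟶ cokerObj f := N.quotπ _ _

lemma kerι_comp : kerι f ≫ f = 0 := by ext m; exact m.2

lemma comp_cokerπ : f ≫ cokerπ f = 0 := by
  ext m; exact (Submodule.Quotient.mk_eq_zero _).2 ⟨m, rfl⟩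

variable {f}

lemma injective_of_mono [Mono f] : Function.Injective (lin f) := by
  have h : kerι f = 0 := (cancel_mono f).1 (by rw [kerι_comp, zero_comp])
  rw [← LinearMap.ker_eq_bot, eq_bot_iff]
  intro m hm
  exact congrArg (fun φ => lin φ (⟨m, hm⟩ : LinearMap.ker (lin f))) h

lemma surjective_of_epi [Epi f] : Function.Surjective (lin f) := by
  have h : cokerπ f = 0 := (cancel_epi f).1 (by rw [comp_cokerπ, comp_zero])
  intro n
  exact (Submodule.Quotient.mk_eq_zero (LinearMap.range (lin f))).1
    (congrArg (fun φ => lin φ n) h)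

lemma mono_of_injective (hf : Function.Injective (lin f)) : Mono f :=
  ⟨fun a b h => by ext m; exact hf (congrArg (fun φ => lin φ m) h)⟩

lemma epi_of_surjective (hf : Function.Surjective (lin f)) : Epi f :=
  ⟨fun a b h => by
    ext n; obtain ⟨m, rfl⟩ := hf n; exact congrArg (fun φ => lin φ m) h⟩

/-- An injective morphism is a kernel of every morphism with which it forms an exact sequence. -/
noncomputable def isLimitOfExact {L : EqMod P} {f : M ⟶ N} {p : N ⟶ L} (w : f ≫ p = 0)
    (hf : Function.Injective (lin f)) (h : ∀ n, lin p n = 0 → ∃ m, lin f m = n) :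
    IsLimit (KernelFork.ofι f w) :=
  haveI := mono_of_injective hf
  KernelFork.IsLimit.ofι' f w fun {A} t ht => by
    have hr : ∀ a, lin t a ∈ LinearMap.range (lin f) := fun a =>
      h _ (congrArg (fun φ => lin φ a) ht)
    let e := LinearEquiv.ofInjective (lin f) hf
    have he : ∀ a, lin f (e.symm ⟨lin t a, hr a⟩) = lin t a := fun a =>
      congrArg Subtype.val (e.apply_symm_apply ⟨lin t a, hr a⟩)
    exact ⟨mkHom (e.symm.toLinearMap ∘ₗ (lin t).codRestrict _ hr) (fun g a => by
      apply hf
      have h₁ := he (A.ρ g a)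
      have h₂ := he a
      rw [lin_comm]
      exact h₁.trans ((lin_comm t g a).trans (congrArg (N.ρ g) h₂.symm))), by
      ext a; exact he a⟩

/-- A surjective morphism is a cokernel of every morphism with which it forms an exact sequence. -/
noncomputable def isColimitOfExact {L : EqMod P} {i : L ⟶ M} {f : M ⟶ N} (w : i ≫ f = 0)
    (hf : Function.Surjective (lin f)) (h : ∀ m, lin f m = 0 → ∃ l, lin i l = m) :
    IsColimit (CokernelCofork.ofπ f w) :=
  haveI := epi_of_surjective hf
  CokernelCofork.IsColimit.ofπ' f w fun {A} t ht => by
    have hk : LinearMap.ker (lin f) ≤ LinearMap.ker (lin t) := fun m hm => by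
      obtain ⟨l, rfl⟩ := h m hm
      exact congrArg (fun φ => lin φ l) ht
    let e := (lin f).quotKerEquivOfSurjective hf
    let s : N →ₗ[P] A := (LinearMap.ker (lin f)).liftQ (lin t) hk ∘ₗ e.symm.toLinearMap
    have hs : ∀ m, s (lin f m) = lin t m := fun m => by
      have : e.symm (lin f m) = (LinearMap.ker (lin f)).mkQ m :=
        e.symm_apply_eq.2 rfl
      simp only [s, LinearMap.comp_apply, LinearEquiv.coe_coe, this]
      rfl
    exact ⟨mkHom s (fun g n => by
      obtain ⟨m, rfl⟩ := hf n
      rw [← lin_comm f, hs, hs, lin_comm]), by ext m; exact hs m⟩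

end kernels

instance : HasKernels (EqMod P) where
  has_limit f := ⟨⟨⟨KernelFork.ofι (kerι f) (kerι_comp f),
    isLimitOfExact _ Subtype.val_injective fun n hn => ⟨⟨n, hn⟩, rfl⟩⟩⟩⟩

instance : HasCokernels (EqMod P) where
  has_colimit f := ⟨⟨⟨CokernelCofork.ofπ (cokerπ f) (comp_cokerπ f),
    isColimitOfExact _ (Submodule.mkQ_surjective (LinearMap.range (lin f)))
      fun _ hn => (Submodule.Quotient.mk_eq_zero (LinearMap.range (lin f))).1 hn⟩⟩⟩

instance : IsNormalMonoCategory (EqMod P) where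
  normalMonoOfMono f _ := ⟨{
    Z := cokerObj f
    g := cokerπ f
    w := comp_cokerπ f
    isLimit := isLimitOfExact _ injective_of_mono
      fun _ hn => (Submodule.Quotient.mk_eq_zero (LinearMap.range (lin f))).1 hn }⟩

instance : IsNormalEpiCategory (EqMod P) where
  normalEpiOfEpi f _ := ⟨{
    W := kerObj f
    g := kerι f
    w := kerι_comp f
    isColimit := isColimitOfExact _ surjective_of_epi fun m hm => ⟨⟨m, hm⟩, rfl⟩ }⟩

noncomputable instance : Abelian (EqMod P) where

instance : HasExt.{u + 1} (EqMod P) := HasExt.standard _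

end EqMod

end Modules

section Artinian

/-- The property of being an Artinian local `k`-algebra with residue field `k`. -/
def isArt (k : Type u) [Field k] : ObjectProperty (CommAlgCat.{u} k) := fun A =>
  ∃ _ : IsLocalRing A, IsArtinianRing A ∧
    Function.Bijective (algebraMap k (IsLocalRing.ResidueField A))

/-- The category of Artinian local `k`-algebras with residue field `k`. -/
abbrev Art (k : Type u) [Field k] := (isArt k).FullSubcategory

namespace Art

variable {k : Type u} [Field k]

instance : CoeSort (Art k) (Type u) := ⟨fun A => A.obj⟩

instance (A : Art k) : IsLocalRing A := A.property.1

/-- The `k`-algebra homomorphism underlying a morphism. -/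
abbrev alg {A B : Art k} (f : A ⟶ B) : A →ₐ[k] B := f.hom.hom

/-- The augmentation `A → A / 𝔪_A = k`. -/
noncomputable def aug (A : Art k) : A →ₐ[k] k :=
  ((AlgEquiv.ofBijective (Algebra.ofId k (IsLocalRing.ResidueField A)) A.property.2.2).symm :
    IsLocalRing.ResidueField A →ₐ[k] k).comp
    (IsScalarTower.toAlgHom k A (IsLocalRing.ResidueField A))

lemma aug_eq_zero {A : Art k} {a : A} : A.aug a = 0 ↔ a ∈ IsLocalRing.maximalIdeal A := by
  rw [← IsLocalRing.residue_eq_zero_iff]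
  simp only [aug, AlgHom.comp_apply]
  exact map_eq_zero_iff _ (AlgEquiv.injective _)

lemma algHom_eq_aug {A : Art k} (χ : A →ₐ[k] k) : χ = A.aug := by
  ext a
  have h : a - algebraMap k A (A.aug a) ∈ IsLocalRing.maximalIdeal A := by
    rw [← aug_eq_zero, map_sub, AlgHom.commutes]; simp
  have h' : χ (a - algebraMap k A (A.aug a)) = 0 := by
    by_contra hne
    set x := a - algebraMap k A (A.aug a)
    have hc : IsUnit (algebraMap k A (χ x)) := (Ne.isUnit hne).map (algebraMap k A)
    have hu : IsUnit (x - algebraMap k A (χ x)) := by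
      by_contra hu
      exact (IsLocalRing.mem_maximalIdeal _).1
        (by simpa using sub_mem h ((IsLocalRing.mem_maximalIdeal _).2 hu)) hc
    exact (hu.map χ).ne_zero (by simp)
  rw [map_sub, AlgHom.commutes, sub_eq_zero] at h'
  exact h'

lemma aug_comp {A B : Art k} (f : A ⟶ B) : B.aug.comp (alg f) = A.aug := algHom_eq_aug _

end Art

end Artinian

/-- Flatness of a quotient of `A ⊗ P` is preserved by base change. -/
lemma flat_quotient_map {k A B P : Type u} [CommRing k] [CommRing A] [Algebra k A] [CommRing B]
    [Algebra k B] [CommRing P] [Algebra k P] (φ : A →ₐ[k] B) (Z : Ideal (A ⊗[k] P))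
    [Module.Flat A ((A ⊗[k] P) ⧸ Z)] :
    Module.Flat B ((B ⊗[k] P) ⧸ Z.map (Algebra.TensorProduct.map φ (AlgHom.id k P))) := by
  let _ := φ.toAlgebra
  have : IsScalarTower k A B := .of_algebraMap_eq fun c => (φ.commutes c).symm
  let e := Algebra.TensorProduct.cancelBaseChange k A B B P
  let l : B ⊗[A] (A ⊗[k] P) →ₐ[B] B ⊗[A] ((A ⊗[k] P) ⧸ Z) :=
    Algebra.TensorProduct.map (AlgHom.id B B) (Ideal.Quotient.mkₐ A Z)
  have hl : Function.Surjective l :=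
    LinearMap.lTensor_surjective B (g := (Ideal.Quotient.mkₐ A Z).toLinearMap)
      (Ideal.Quotient.mkₐ_surjective A Z)
  have hk : RingHom.ker l = Z.map (Algebra.TensorProduct.includeRight : A ⊗[k] P →ₐ[A] _) := by
    have := Algebra.TensorProduct.lTensor_ker (A := B) (Ideal.Quotient.mkₐ A Z)
      (Ideal.Quotient.mkₐ_surjective A Z)
    have hq : RingHom.ker (Ideal.Quotient.mkₐ A Z) = Z :=
      Ideal.ext fun _ => Ideal.Quotient.eq_zero_iff_mem
    rw [hq] at this
    exact this
  let g : B ⊗[k] P →ₐ[B] B ⊗[A] ((A ⊗[k] P) ⧸ Z) := l.comp e.symm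
  have hg : Function.Surjective g := hl.comp e.symm.surjective
  have hgk : RingHom.ker g = Z.map (Algebra.TensorProduct.map φ (AlgHom.id k P)) := by
    have h1 : RingHom.ker g = (RingHom.ker l).comap (e.symm : B ⊗[k] P →+* _) := rfl
    have h2 : (RingHom.ker l).comap (e.symm : B ⊗[k] P →+* _) =
        (RingHom.ker l).map (e : B ⊗[A] (A ⊗[k] P) →+* _) :=
      (Ideal.map_comap_of_equiv (e : B ⊗[A] (A ⊗[k] P) ≃+* B ⊗[k] P)).symm
    rw [h1, h2, hk]
    refine (Ideal.map_map (Algebra.TensorProduct.includeRight : A ⊗[k] P →ₐ[A] _).toRingHom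
      (e : B ⊗[A] (A ⊗[k] P) →+* B ⊗[k] P)).trans ?_
    have h3 : ((e : B ⊗[A] (A ⊗[k] P) →ₐ[B] _).restrictScalars k).comp
        ((Algebra.TensorProduct.includeRight : A ⊗[k] P →ₐ[A] B ⊗[A] (A ⊗[k] P)).restrictScalars k)
        = Algebra.TensorProduct.map φ (AlgHom.id k P) := by
      ext x
      · simp [e, Algebra.smul_def]; rfl
      · simp [e]
    rw [← h3]; rfl
  rw [← hgk]
  exact Module.Flat.of_linearEquiv (Ideal.quotientKerAlgEquivOfSurjective hg).toLinearEquiv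

section Deformations

variable {k G : Type u} [Field k] [Group G] {𝒢 : AlgGroup k G}

/-- The `G`-algebra `P_A = A ⊗ P`, where `G` acts trivially on `A`. -/
noncomputable def GAlg.baseChange (P : GAlg 𝒢) (A : Type u) [CommRing A] [Algebra k A] :
    GAlg 𝒢 where
  carrier := A ⊗[k] P
  act :=
    { toFun g := Algebra.TensorProduct.congr AlgEquiv.refl (P.act g)
      map_one' := by
        ext x
        induction x using TensorProduct.induction_on with
        | zero => simp
        | tmul a p => simp
        | add x y hx hy => rw [map_add, hx, hy, map_add]
      map_mul' g h := by
        ext x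
        induction x using TensorProduct.induction_on with
        | zero => simp
        | tmul a p => simp
        | add x y hx hy => rw [map_add, hx, hy, map_add] }
  rational := .of_injective
    (σ := (Representation.trivial k G A).tprod P.rep) LinearMap.id Function.injective_id
    (fun g x => by
      induction x using TensorProduct.induction_on with
      | zero => simp
      | tmul a p => simp
      | add x y hx hy => simp only [map_add] at hx hy ⊢; rw [hx, hy])
    (.tprod .trivial P.rational)

variable (P : GAlg 𝒢)

/-- The ring homomorphism `P_A → P_B` induced by `A → B`. -/
noncomputable def GAlg.reduce {A B : Art k} (f : A ⟶ B) :
    P.baseChange A →ₐ[k] P.baseChange B :=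
  Algebra.TensorProduct.map (Art.alg f) (AlgHom.id k P)

/-- The reduction map `P_A → P` modulo the maximal ideal of `A`. -/
noncomputable def GAlg.specialize (A : Art k) : P.baseChange A →ₐ[k] P :=
  Algebra.TensorProduct.lift (A := A) (B := P) ((Algebra.ofId k P).comp A.aug) (AlgHom.id k P)
    fun _ _ => .all _ _

/-- A `G`-stable deformation over `A`, inside `Spec P`, of the closed subscheme with ideal `I`,
given by its ideal in `P_A`: it is `G`-stable, flat over `A`, and its fibre over the closed point
is the subscheme with ideal `I`. -/
structure IsDeformation (I : Ideal P) (A : Art k) (Z : Ideal (P.baseChange A)) : Prop where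
  stable : ∀ g, ∀ x ∈ Z, (P.baseChange A).act g x ∈ Z
  flat : Module.Flat A ((A ⊗[k] P) ⧸ (show Ideal (A ⊗[k] P) from Z))
  fiber : Z.map (P.specialize A) = I

variable {P}

lemma reduce_act {A B : Art k} (f : A ⟶ B) (g : G) (x : P.baseChange A) :
    P.reduce f ((P.baseChange A).act g x) = (P.baseChange B).act g (P.reduce f x) := by
  change A ⊗[k] P at x
  induction x using TensorProduct.induction_on with
  | zero => exact (map_zero _).trans (map_zero _).symm
  | tmul a p => rfl
  | add x y hx hy =>
    refine Eq.trans ?_ ((congrArg₂ (· + ·) hx hy).trans ?_)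
    · exact (congrArg _ (map_add _ _ _)).trans (map_add _ _ _)
    · exact ((congrArg _ (map_add _ _ _)).trans (map_add _ _ _)).symm

lemma specialize_comp_reduce {A B : Art k} (f : A ⟶ B) :
    (P.specialize B).comp (P.reduce f) = P.specialize A := by
  refine Algebra.TensorProduct.ext (A := A) (B := P) ?_ ?_
  · ext a
    change algebraMap k P (B.aug (Art.alg f a)) * 1 = algebraMap k P (A.aug a) * 1
    rw [← Art.aug_comp f]
    rfl
  · ext p
    change algebraMap k P (B.aug (Art.alg f 1)) * p = algebraMap k P (A.aug 1) * p
    simp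

lemma IsDeformation.map {I : Ideal P} {A B : Art k} {Z : Ideal (P.baseChange A)}
    (hZ : IsDeformation P I A Z) (f : A ⟶ B) :
    IsDeformation P I B (Z.map (P.reduce f)) where
  stable g x hx := by
    have : Z.map (P.reduce f) ≤
        (Z.map (P.reduce f)).comap ((P.baseChange B).act g : _ →+* P.baseChange B) := by
      rw [Ideal.map_le_iff_le_comap]
      intro z hz
      change (P.baseChange B).act g (P.reduce f z) ∈ Z.map (P.reduce f)
      rw [← reduce_act]
      exact Ideal.mem_map_of_mem _ (hZ.stable g z hz)
    exact this hx
  flat := by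
    have := hZ.flat
    exact flat_quotient_map (Art.alg f) (show Ideal (A ⊗[k] P) from Z)
  fiber := by
    refine Eq.trans ?_ hZ.fiber
    rw [← specialize_comp_reduce f]
    exact Ideal.map_map (P.reduce f).toRingHom (P.specialize B).toRingHom

end Deformations

/-- The functor of infinitesimal `G`-stable deformations, inside `Spec P`, of the closed subscheme
with ideal `I`. -/
noncomputable def deformationFunctor {k G : Type u} [Field k] [Group G] {𝒢 : AlgGroup k G} (P : GAlg 𝒢) (I : Ideal P) : Art k ⥤ Type u where
  obj A := {Z : Ideal (P.baseChange A) // IsDeformation P I A Z}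
  map f := ↾fun Z => ⟨Z.1.map (P.reduce f), Z.2.map f⟩
  map_id A := by
    refine ConcreteCategory.hom_ext _ _ fun Z => Subtype.ext ?_
    have h : (P.reduce (𝟙 A)) = AlgHom.id k _ := Algebra.TensorProduct.map_id
    change Ideal.map (P.reduce (𝟙 A)) Z.1 = Z.1
    rw [h]
    exact Ideal.map_id Z.1
  map_comp f g := by
    refine ConcreteCategory.hom_ext _ _ fun Z => Subtype.ext ?_
    have h : P.reduce (f ≫ g) = (P.reduce g).comp (P.reduce f) := by
      refine Algebra.TensorProduct.ext (A := _) (B := P) ?_ ?_ <;> ext <;> rfl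
    change Ideal.map (P.reduce (f ≫ g)) Z.1 = Ideal.map (P.reduce g) (Ideal.map (P.reduce f) Z.1)
    rw [h]
    exact (Ideal.map_map (P.reduce f).toRingHom (P.reduce g).toRingHom).symm

section Obstructions

variable (k : Type u) [Field k]

/-- A small extension `0 → J → A' → A → 0`: a surjection in `Art` whose kernel is killed by the
maximal ideal of `A'`. -/
structure SmallExtension where
  total : Art k
  base : Art k
  proj : total ⟶ base
  surjective : Function.Surjective (Art.alg proj)
  small : ∀ a ∈ IsLocalRing.maximalIdeal total, ∀ j, Art.alg proj j = 0 → a * j = 0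

namespace SmallExtension

variable {k}

/-- The kernel `J` of a small extension, as a `k`-vector space. -/
def ker (E : SmallExtension k) : Submodule k E.total :=
  LinearMap.ker (Art.alg E.proj).toLinearMap

/-- A morphism of small extensions. -/
structure Hom (E E' : SmallExtension k) where
  onTotal : E.total ⟶ E'.total
  onBase : E.base ⟶ E'.base
  comm : E.proj ≫ onBase = onTotal ≫ E'.proj

/-- The map between kernels induced by a morphism of small extensions. -/
def Hom.kerMap {E E' : SmallExtension k} (f : E.Hom E') : E.ker →ₗ[k] E'.ker :=
  (Art.alg f.onTotal).toLinearMap.restrict fun x hx => by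
    have h := congrArg (fun φ => Art.alg φ x) f.comm
    have hx' : Art.alg E.proj x = 0 := hx
    change Art.alg E'.proj (Art.alg f.onTotal x) = 0
    refine h.symm.trans ?_
    change Art.alg f.onBase (Art.alg E.proj x) = 0
    rw [hx', map_zero]

end SmallExtension

variable {k}

/-- The maps `ob` are obstruction maps which make `V` an obstruction space of the functor `F`. -/
structure IsObstructionTheory (F : Art k ⥤ Type u) (V : Type v) [AddCommGroup V] [Module k V]
    (ob : ∀ E : SmallExtension k, F.obj E.base → E.ker ⊗[k] V) : Prop where
  finite : Module.Finite k V
  exact : ∀ (E : SmallExtension k) (x : F.obj E.base),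
    ob E x = 0 ↔ ∃ y : F.obj E.total, F.map E.proj y = x
  natural : ∀ (E E' : SmallExtension k) (f : E.Hom E') (x : F.obj E.base),
    f.kerMap.rTensor V (ob E x) = ob E' (F.map f.onBase x)

end Obstructions

namespace EqMod

variable {k G : Type u} [Field k] [Group G] {𝒢 : AlgGroup k G}

/-- The `(P, G)`-module `P`. -/
def self (P : GAlg 𝒢) : EqMod P where
  carrier := P
  ρ := P.rep
  semilinear g p m := map_mul (P.act g) p m
  rational := P.rational

/-- The `(P, G)`-module `P ⊗ N` for a rational `G`-module `N`, with the diagonal action of `G`. -/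
noncomputable def free (P : GAlg 𝒢) {N : Type u} [AddCommGroup N] [Module k N]
    (σ : Representation k G N) (hσ : 𝒢.IsRational σ) : EqMod P where
  carrier := P ⊗[k] N
  ρ := P.rep.tprod σ
  semilinear g p m := by
    induction m using TensorProduct.induction_on with
    | zero => simp
    | tmul q n => simp [TensorProduct.smul_tmul']
    | add x y hx hy => simp only [smul_add, map_add, hx, hy]
  rational := .tprod P.rational hσ

lemma rational_subrep {P : GAlg 𝒢} (M : EqMod P) (N : Subrepresentation M.ρ) :
    𝒢.IsRational N.toRepresentation :=
  .of_injective (W := M) N.toSubmodule.subtype Subtype.val_injective (fun _ _ => rfl) M.rational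

/-- The morphism `P ⊗ N → M`, `p ⊗ n ↦ p n`, for a `G`-submodule `N` of a `(P, G)`-module `M`. -/
noncomputable def spanHom {P : GAlg 𝒢} (M : EqMod P) (N : Subrepresentation M.ρ) :
    free P N.toRepresentation (M.rational_subrep N) ⟶ M :=
  mkHom (M := free P N.toRepresentation (M.rational_subrep N))
    (LinearMap.liftBaseChange P N.toSubmodule.subtype) fun g x => by
    have key (x : P ⊗[k] N.toSubmodule) : LinearMap.liftBaseChange P N.toSubmodule.subtype
        (TensorProduct.map (P.rep g) (N.toRepresentation g) x) =
          M.ρ g (LinearMap.liftBaseChange P N.toSubmodule.subtype x) := by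
      induction x using TensorProduct.induction_on with
      | zero => simp
      | tmul q n =>
        simp only [TensorProduct.map_tmul, LinearMap.liftBaseChange_tmul, M.semilinear]
        rfl
      | add x y hx hy => simp only [map_add, hx, hy]
    exact key x

/-- Evaluation of morphisms at an element. -/
def evalAt {P : GAlg 𝒢} {M : EqMod P} (N : EqMod P) (m : M) : (M ⟶ N) →ₗ[k] N where
  toFun f := lin f m
  map_add' _ _ := rfl
  map_smul' _ _ := rfl

end EqMod

section Presentations

variable {k G : Type u} [Field k] [Group G] {𝒢 : AlgGroup k G}

open EqMod

/-- A `G`-equivariant presentation `P ⊗ N₂ → P ⊗ N₁ → P → P / I → 0` given by finite-dimensional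
`G`-submodules `N₁` of `P` and `N₂` of `P ⊗ N₁`, with the maps `1 ⊗ f ↦ f` and `1 ⊗ r ↦ r`. -/
structure EquivariantPresentation (P : GAlg 𝒢) (I : Ideal P) where
  N₁ : Subrepresentation (self P).ρ
  finite₁ : FiniteDimensional k N₁.toSubmodule
  range_eq : LinearMap.range (lin (spanHom (self P) N₁)) = I
  N₂ : Subrepresentation (free P N₁.toRepresentation (rational_subrep _ N₁)).ρ
  finite₂ : FiniteDimensional k N₂.toSubmodule
  exact : LinearMap.range (lin (spanHom _ N₂)) = LinearMap.ker (lin (spanHom (self P) N₁))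

namespace EquivariantPresentation

variable {P : GAlg 𝒢} {I : Ideal P} (p : EquivariantPresentation P I)

/-- The `(Q, G)`-module `Q ⊗ N₁`. -/
noncomputable def F₁ (Q : GAlg 𝒢) : EqMod Q :=
  free Q p.N₁.toRepresentation (rational_subrep _ p.N₁)

/-- The `(Q, G)`-module `Q ⊗ N₂`. -/
noncomputable def F₂ (Q : GAlg 𝒢) : EqMod Q :=
  free Q p.N₂.toRepresentation (rational_subrep _ p.N₂)

/-- The morphism `u₀ : P ⊗ N₁ → P`. -/
noncomputable def u₀ : p.F₁ P ⟶ self P := spanHom (self P) p.N₁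

/-- The morphism `v₀ : P ⊗ N₂ → P ⊗ N₁`. -/
noncomputable def v₀ : p.F₂ P ⟶ p.F₁ P := spanHom (p.F₁ P) p.N₂

/-- The map `μ^G : Hom_P^G(P ⊗ N₁, P) ⊕ Hom_P^G(P ⊗ N₂, P ⊗ N₁) → Hom_P^G(P ⊗ N₂, P)`,
`(C, D) ↦ C v₀ + u₀ D`. Bases of `N₁` and `N₂` turn these morphisms into the equivariant matrices. -/
noncomputable def μ : ((p.F₁ P ⟶ self P) × (p.F₂ P ⟶ p.F₁ P)) →ₗ[k] (p.F₂ P ⟶ self P) :=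
  (Linear.leftComp k (self P) p.v₀).coprod (Linear.rightComp k (p.F₂ P) p.u₀)

/-- The vector space `N^G`, the cokernel of `μ^G`. -/
abbrev NG : Type u := (p.F₂ P ⟶ self P) ⧸ LinearMap.range p.μ

/-- The first syzygy module `K = Ker u₀`, which is the image of `v₀`. -/
noncomputable def syzygy : EqMod P := kerObj p.u₀

/-- The morphism `v₀`, seen as a surjection to `K`. -/
noncomputable def toSyzygy : p.F₂ P ⟶ p.syzygy :=
  mkHom (N := p.syzygy)
    ((lin p.v₀).codRestrict (LinearMap.ker (lin p.u₀)) fun x => p.exact.le ⟨x, rfl⟩)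
    fun g x => Subtype.ext (lin_comm p.v₀ g x)

end EquivariantPresentation

/-- The `(P, G)`-module `I`, for a `G`-stable ideal `I`. -/
def idealObj (P : GAlg 𝒢) (I : Ideal P) (hI : ∀ g, ∀ x ∈ I, P.act g x ∈ I) : EqMod P :=
  (self P).sub I hI

/-- The `(P, G)`-module `P / I`, for a `G`-stable ideal `I`. -/
noncomputable def quotientObj (P : GAlg 𝒢) (I : Ideal P) (hI : ∀ g, ∀ x ∈ I, P.act g x ∈ I) :
    EqMod P :=
  (self P).quot I hI

/-- The projection `P → P / I`. -/
noncomputable def quotientProj (P : GAlg 𝒢) (I : Ideal P) (hI : ∀ g, ∀ x ∈ I, P.act g x ∈ I) :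
    self P ⟶ quotientObj P I hI :=
  (self P).quotπ I hI

/-- `Ext^{1,G}_P(I, P / I)`: the first `Ext` in the abelian category of `(P, G)`-modules. -/
abbrev ExtOne (P : GAlg 𝒢) (I : Ideal P) (hI : ∀ g, ∀ x ∈ I, P.act g x ∈ I) : Type (u + 1) :=
  CategoryTheory.Abelian.Ext.{u + 1} (idealObj P I hI) (quotientObj P I hI) 1

namespace EquivariantPresentation

variable {P : GAlg 𝒢} {I : Ideal P} (p : EquivariantPresentation P I)
  (hI : ∀ g, ∀ x ∈ I, P.act g x ∈ I)

/-- The morphism `u₀`, seen as a surjection to `I`. -/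
noncomputable def toIdeal : p.F₁ P ⟶ idealObj P I hI :=
  mkHom (N := idealObj P I hI)
    ((lin p.u₀).codRestrict I fun x => p.range_eq.le ⟨x, rfl⟩)
    fun g x => Subtype.ext (lin_comm p.u₀ g x)

/-- The sequence `K → P ⊗ N₁ → I`. -/
noncomputable def syzygySequence : ShortComplex (EqMod P) where
  X₁ := p.syzygy
  X₂ := p.F₁ P
  X₃ := idealObj P I hI
  f := kerι p.u₀
  g := p.toIdeal hI
  zero := by ext m; exact Subtype.ext m.2

lemma syzygySequence_shortExact : (p.syzygySequence hI).ShortExact where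
  exact := ShortComplex.exact_of_f_is_kernel _ <|
    isLimitOfExact (p.syzygySequence hI).zero Subtype.val_injective
      fun n hn => ⟨⟨n, congrArg Subtype.val hn⟩, rfl⟩
  mono_f := mono_of_injective Subtype.val_injective
  epi_g := epi_of_surjective fun x => by
    obtain ⟨y, hy⟩ := p.range_eq.ge x.2
    exact ⟨y, Subtype.ext hy⟩

/-- The connecting map `Hom_P^G(K, P / I) → Ext^{1,G}_P(I, P / I)` of the short exact sequence
`0 → K → P ⊗ N₁ → I → 0`. It sends `ψ` to the class of the cocycle `ψ v₀`. -/
noncomputable def connecting : (p.syzygy ⟶ quotientObj P I hI) →ₗ[k] ExtOne P I hI :=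
  (Abelian.Ext.bilinearCompOfLinear k (idealObj P I hI) p.syzygy (quotientObj P I hI) 1 0 1 rfl
    (p.syzygySequence_shortExact hI).extClass) ∘ₗ
    (Abelian.Ext.linearEquiv₀ (R := k)).symm.toLinearMap

/-- The map `Q ⊗ N₁ → Q' ⊗ N₁` induced by a `k`-algebra homomorphism `Q → Q'`. -/
noncomputable def map₁ {Q Q' : GAlg 𝒢} (φ : Q →ₐ[k] Q') : p.F₁ Q →ₗ[k] p.F₁ Q' :=
  φ.toLinearMap.rTensor p.N₁.toSubmodule

/-- The map `Q ⊗ N₂ → Q' ⊗ N₂` induced by a `k`-algebra homomorphism `Q → Q'`. -/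
noncomputable def map₂ {Q Q' : GAlg 𝒢} (φ : Q →ₐ[k] Q') : p.F₂ Q →ₗ[k] p.F₂ Q' :=
  φ.toLinearMap.rTensor p.N₂.toSubmodule

/-- A presentation `(u, v)` over `A` of the deformation with ideal `Z`, whose reduction modulo the
maximal ideal of `A` is `(u₀, v₀)`: an exact sequence of `(P_A, G)`-modules
`P_A ⊗ N₂ → P_A ⊗ N₁ → P_A → P_A / Z → 0`. -/
structure Lifts (A : Art k) (Z : Ideal (P.baseChange A))
    (u : p.F₁ (P.baseChange A) ⟶ self (P.baseChange A))
    (v : p.F₂ (P.baseChange A) ⟶ p.F₁ (P.baseChange A)) : Prop where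
  range_eq : LinearMap.range (lin u) = Z
  exact : LinearMap.range (lin v) = LinearMap.ker (lin u)
  specialize_u : ∀ x, P.specialize A (lin u x) = lin p.u₀ (p.map₁ (P.specialize A) x)
  specialize_v : ∀ x, p.map₁ (P.specialize A) (lin v x) = lin p.v₀ (p.map₂ (P.specialize A) x)

/-- The relation `ob(Z) = c` which defines the obstruction map with values in
`J ⊗ Ext^{1,G}_P(I, P / I)`. Choose a presentation `(u, v)` of the deformation `Z` over `A` and
equivariant lifts `(u', v')` of `(u, v)` to `A'`. Then `u' v'` takes values in `J ⊗ P`, and modulo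
`I` it gives a cocycle `η = z v₀` for some `z ∈ J ⊗ Hom_P^G(K, P / I)`, whose class is `c`. -/
def ObRel (E : SmallExtension k) (Z : (deformationFunctor P I).obj E.base)
    (c : E.ker ⊗[k] ExtOne P I hI) : Prop :=
  ∃ (u : p.F₁ (P.baseChange E.base) ⟶ self (P.baseChange E.base))
    (v : p.F₂ (P.baseChange E.base) ⟶ p.F₁ (P.baseChange E.base))
    (u' : p.F₁ (P.baseChange E.total) ⟶ self (P.baseChange E.total))
    (v' : p.F₂ (P.baseChange E.total) ⟶ p.F₁ (P.baseChange E.total))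
    (z : E.ker ⊗[k] (p.syzygy ⟶ quotientObj P I hI)),
    p.Lifts E.base Z.1 u v ∧
    (∀ x, P.reduce E.proj (lin u' x) = lin u (p.map₁ (P.reduce E.proj) x)) ∧
    (∀ x, p.map₁ (P.reduce E.proj) (lin v' x) = lin v (p.map₂ (P.reduce E.proj) x)) ∧
    (∀ n : p.N₂.toSubmodule, ∃ t : E.ker ⊗[k] P,
      E.ker.subtype.rTensor P t =
        lin u' (lin v' ((1 : P.baseChange E.total) ⊗ₜ[k] n : P.baseChange E.total ⊗[k] _)) ∧
      ((lin (quotientProj P I hI)).restrictScalars k).lTensor E.ker t =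
        (evalAt (quotientObj P I hI)
          (lin p.toSyzygy ((1 : P) ⊗ₜ[k] n : P ⊗[k] _))).lTensor E.ker z) ∧
    c = (p.connecting hI).lTensor E.ker z

end EquivariantPresentation

end Presentations

/-! Rational representations are locally finite, so reductivity makes all of them completely
reducible, and equivariant maps lift along surjections of rational representations
(`IsReductive.exists_lift`). Hence `P ⊗ N` is projective among `(P, G)`-modules, and `Ext^{1,G}(I,
P/I)` is `Hom(K, P/I)` modulo restrictions of maps `P ⊗ N₁ → P/I`. A lift `C` of `ψ v₀` is unique up
to maps into `I`, which are exactly the `u₀ D`; and `ψ` extends to `P ⊗ N₁` if and only if `C = B v₀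
+ u₀ D`. So the class of `C` in `N^G` detects the class of `ψ` (`exists_extOne_embedding`).
Finiteness holds because `Hom_P^G(P ⊗ N₂, P/I)`, which embeds into `Hom^G(N₂, P/I)`, contains
`Hom(K, P/I)` and maps onto `N^G`.

Write `m` for the nilpotent maximal ideal of `A`. Flatness of `P_A / Z` over `A` means `Z ∩ m P_A ⊆
m Z`. For `Z = im u` this says that the relations `ker u₀` lift to `ker u`; it also makes `im u` a
direct summand over `A`, so that `ker u ∩ m F ⊆ m ker u`, where `F = P_A ⊗ N₁`. By Nakayama, a
complex lifting the given presentation is then automatically exact. This gives presentations of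
deformations (`exists_lifts`) and, conversely, deformations from lifted relations
(`isDeformation_range`).

The key to the obstruction is `value_eq_zero`: if `u' x` lies in `J ⊗ P`, its class in `J ⊗ P/I`
depends only on the reduction of `x` to `P ⊗ N₁`. Indeed, if that reduction is zero, the image of
`x` over `A` is in `m ker u`. It lifts to a sum of products `r y` with `r` zero modulo the maximal
ideal of `A'` and `u' y` in `J ⊗ P`, and these are killed by `u'`; what remains is in `J ⊗ P ⊗ N₁`,
which `u'` maps to `J ⊗ I`. So the cocycle `K → J ⊗ P/I` is determined by `u'` alone. Two choices of
`u'` agree modulo `J` after composition with some `1 + a`, `a ≡ 0` modulo the maximal ideal, and the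
rest is a map defined on `P ⊗ N₁`, hence a coboundary (`IsCocycle.exists_sub_eq`). If the class
vanishes, a correction of `u'` by a map on `P ⊗ N₁` moves the cocycle into `J ⊗ I`, where it is
absorbed by changing the lifts of syzygies; so the relations lift and the new image is a deformation
(`exists_lift_of_obRel_zero`). Naturality is extension of scalars, and `id_J ⊗ ι` is injective, so
it preserves the vanishing criterion. -/

/-! ### Flat quotients and direct summands over a ring with nilpotent maximal ideal -/

section NilpotentIdeals

/-- Nakayama's lemma for a nilpotent ideal. -/
theorem Submodule.le_of_le_sup_smul_of_isNilpotent {R M : Type*} [CommRing R] [AddCommGroup M]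
    [Module R M] {I : Ideal R} (hI : IsNilpotent I) {N N' : Submodule R M}
    (h : N ≤ N' ⊔ I • N) : N ≤ N' := by
  have key : ∀ n : ℕ, N ≤ N' ⊔ I ^ n • N := by
    intro n
    induction n with
    | zero => simp
    | succ n ih =>
      refine ih.trans (sup_le le_sup_left ((Submodule.smul_mono le_rfl h).trans ?_))
      rw [Submodule.smul_sup, ← Submodule.mul_smul, ← pow_succ]
      exact sup_le (Submodule.smul_le_right.trans le_sup_left) le_sup_right
  obtain ⟨n, hn⟩ := hI
  simpa [hn] using key n

variable {A F F' : Type*} [CommRing A] [AddCommGroup F] [Module A F] [AddCommGroup F'] [Module A F']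

/-- Each application of `f` gains one more factor of `m`. -/
theorem LinearMap.isNilpotent_of_range_le_smul_top {m : Ideal A} (hm : IsNilpotent m)
    (f : F →ₗ[A] F) (hf : ∀ x, f x ∈ m • (⊤ : Submodule A F)) : IsNilpotent f := by
  have key : ∀ n x, (f ^ n) x ∈ m ^ n • (⊤ : Submodule A F) := by
    intro n
    induction n with
    | zero => simp
    | succ n ih =>
      intro x
      rw [pow_succ' f, Module.End.mul_apply, pow_succ, Submodule.mul_smul]
      have h1 : (m ^ n • (⊤ : Submodule A F)).map f ≤ m ^ n • m • ⊤ := by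
        rw [Submodule.map_smul'']
        exact Submodule.smul_mono le_rfl (by rintro _ ⟨y, -, rfl⟩; exact hf y)
      exact h1 ⟨_, ih x, rfl⟩
  obtain ⟨n, hn⟩ := hm
  refine ⟨n, LinearMap.ext fun x => ?_⟩
  simpa [hn] using key n x

/-- Over a ring with a nilpotent maximal ideal `m`, a submodule `Z` of a projective module `F` with
`Z ∩ m F = m Z` is a direct summand. -/
theorem Submodule.exists_retraction_of_inf_smul_top_le {m : Ideal A} [m.IsMaximal]
    (hm : IsNilpotent m) [Module.Projective A F] {Z : Submodule A F}
    (h : Z ⊓ m • ⊤ ≤ m • Z) : ∃ r : F →ₗ[A] Z, ∀ z : Z, r z = z := by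
  let _ : Field (A ⧸ m) := Ideal.Quotient.field m
  let i : (Z ⧸ (m • ⊤ : Submodule A Z)) →ₗ[A] (F ⧸ (m • ⊤ : Submodule A F)) :=
    Submodule.mapQ _ _ Z.subtype (Submodule.map_le_iff_le_comap.1 (by
      rw [Submodule.map_smul'']; exact Submodule.smul_mono le_rfl le_top))
  have hi : Function.Injective i := by
    rw [← LinearMap.ker_eq_bot, eq_bot_iff]
    intro x hx
    obtain ⟨z, rfl⟩ := Submodule.mkQ_surjective _ x
    have h1 : (z : F) ∈ m • (⊤ : Submodule A F) := (Submodule.Quotient.mk_eq_zero _).1 hx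
    have h2 : (z : F) ∈ m • Z := h ⟨z.2, h1⟩
    have h3 : m • Z = (m • (⊤ : Submodule A Z)).map Z.subtype := by
      rw [Submodule.map_smul'', Submodule.map_top, Submodule.range_subtype]
    rw [h3] at h2
    obtain ⟨z', hz', h4⟩ := h2
    obtain rfl : z' = z := Subtype.ext h4
    exact (Submodule.Quotient.mk_eq_zero _).2 hz'
  let i' : (Z ⧸ (m • ⊤ : Submodule A Z)) →ₗ[A ⧸ m] (F ⧸ (m • ⊤ : Submodule A F)) :=
    { i with
      map_smul' := fun c x => by
        obtain ⟨a, rfl⟩ := Ideal.Quotient.mk_surjective c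
        exact i.map_smul a x }
  -- Split `Z / mZ ↪ F / mF` over the residue field and lift the retraction to `F` by projectivity.
  -- The result is the identity on `Z` only modulo `m`, hence an automorphism of `Z`, and its
  -- inverse corrects it.
  obtain ⟨r₀, hr₀⟩ := i'.exists_leftInverse_of_injective (LinearMap.ker_eq_bot.2 hi)
  obtain ⟨r, hr⟩ := Module.projective_lifting_property (m • ⊤ : Submodule A Z).mkQ
    (r₀.restrictScalars A ∘ₗ (m • ⊤ : Submodule A F).mkQ) (Submodule.mkQ_surjective _)
  have hn : IsNilpotent (r ∘ₗ Z.subtype - 1) := by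
    refine LinearMap.isNilpotent_of_range_le_smul_top hm _ fun z => ?_
    rw [← Submodule.Quotient.mk_eq_zero]
    have h1 := LinearMap.congr_fun hr z.1
    have h2 := LinearMap.congr_fun hr₀ (Submodule.Quotient.mk z)
    have h3 : (Submodule.Quotient.mk (r z.1) : Z ⧸ (m • ⊤ : Submodule A Z)) =
      Submodule.Quotient.mk z := h1.trans h2
    simp [h3]
  have hu : IsUnit (r ∘ₗ Z.subtype) := by simpa using hn.isUnit_add_one
  obtain ⟨s, hs⟩ := hu.exists_left_inv
  exact ⟨s ∘ₗ r, fun z => LinearMap.congr_fun hs z⟩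

/-- A retraction `r` onto `Z` makes `F / Z` a retract of the flat module `F`, via `x ↦ x - r x`. -/
theorem Module.Flat.quotient_of_inf_smul_top_le {m : Ideal A} [m.IsMaximal]
    (hm : IsNilpotent m) [Module.Projective A F] {Z : Submodule A F}
    (h : Z ⊓ m • ⊤ ≤ m • Z) : Module.Flat A (F ⧸ Z) := by
  obtain ⟨r, hr⟩ := Submodule.exists_retraction_of_inf_smul_top_le hm h
  refine Module.Flat.of_retract (M := F) (Z.liftQ (LinearMap.id - Z.subtype ∘ₗ r) fun z hz => ?_)
    Z.mkQ ?_
  · have := congrArg Subtype.val (hr ⟨z, hz⟩)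
    simp [this]
  · ext x
    simp

/-- The range of `f` is a direct summand of `F`, hence projective, so `f` splits over its range. The
resulting projection `q` of `F'` onto `ker f` carries `m F'` into `m ker f` and fixes `ker f`. -/
theorem LinearMap.ker_inf_smul_top_le {m : Ideal A} [m.IsMaximal]
    (hm : IsNilpotent m) [Module.Projective A F] (f : F' →ₗ[A] F)
    (h : range f ⊓ m • ⊤ ≤ m • range f) : ker f ⊓ m • ⊤ ≤ m • ker f := by
  obtain ⟨r, hr⟩ := Submodule.exists_retraction_of_inf_smul_top_le hm h
  have : Module.Projective A (range f) := .of_split (range f).subtype r (LinearMap.ext hr)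
  obtain ⟨s, hs⟩ := Module.projective_lifting_property f.rangeRestrict LinearMap.id
    f.surjective_rangeRestrict
  let q : F' →ₗ[A] ker f := (LinearMap.id - s ∘ₗ f.rangeRestrict).codRestrict _ fun x => by
    have := congrArg Subtype.val (LinearMap.congr_fun hs (f.rangeRestrict x))
    simp only [LinearMap.comp_apply, LinearMap.id_apply] at this
    simp only [mem_ker, LinearMap.sub_apply, map_sub, LinearMap.id_apply, LinearMap.comp_apply]
    rw [sub_eq_zero]
    exact this.symm
  rintro x ⟨hx, hx'⟩
  have hq : q x = ⟨x, hx⟩ := Subtype.ext (by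
    have : f.rangeRestrict x = 0 := Subtype.ext hx
    simp [q, this])
  have h1 : (m • (⊤ : Submodule A F')).map ((ker f).subtype ∘ₗ q) ≤ m • ker f := by
    rw [Submodule.map_smul'']
    exact Submodule.smul_mono le_rfl (by rintro _ ⟨y, -, rfl⟩; exact (q y).2)
  exact h1 ⟨x, hx', congrArg Subtype.val hq⟩

/-- Equational criterion: if `x = ∑ f i • x i` lies in `Z`, the relation is trivial modulo `Z`, so
`x i ≡ ∑ a i j • y j` with `∑ f i * a i j = 0`. Subtracting these sums leaves `x` unchanged and puts
the vectors into `Z`. -/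
theorem Submodule.inf_smul_top_le_of_flat (m : Ideal A) {Z : Submodule A F}
    [Module.Flat A (F ⧸ Z)] : Z ⊓ m • ⊤ ≤ m • Z := by
  rintro x ⟨hxZ, hx⟩
  obtain ⟨ι, f, hf, x, rfl⟩ : ∃ (ι : Finset F) (f : ι → A), (∀ i, f i ∈ m) ∧
      ∃ y : ι → F, ∑ i, f i • y i = x := by
    obtain ⟨c, hc, rfl⟩ := (Submodule.mem_ideal_smul_span_iff_exists_sum m (id : F → F) x).1
      (by simpa using hx)
    refine ⟨c.support, fun i => c i, fun i => hc i, fun i => i, ?_⟩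
    exact Finset.sum_coe_sort c.support fun i => c i • i
  have h0 : ∑ i, f i • Z.mkQ (x i) = 0 := by
    simp only [← map_smul, ← map_sum]
    exact (Submodule.Quotient.mk_eq_zero Z).2 hxZ
  obtain ⟨κ, a, y, hy, ha⟩ := Module.Flat.isTrivialRelation_of_sum_smul_eq_zero h0
  choose y' hy' using fun j => Z.mkQ_surjective (y j)
  have h1 : ∀ i, x i - ∑ j, a i j • y' j ∈ Z := fun i => by
    rw [← Submodule.Quotient.mk_eq_zero, ← Submodule.mkQ_apply, map_sub]
    refine sub_eq_zero.2 ((hy i).trans ?_)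
    simp [← hy']
  have h2 : ∑ i, f i • x i = ∑ i, f i • (x i - ∑ j, a i j • y' j) := by
    simp only [smul_sub, Finset.sum_sub_distrib, Finset.smul_sum, smul_smul]
    rw [Finset.sum_comm]
    simp only [← Finset.sum_smul, ha, zero_smul, Finset.sum_const_zero, sub_zero]
  rw [h2]
  exact Submodule.sum_mem _ fun i _ => Submodule.smul_mem_smul (hf i) (h1 i)

end NilpotentIdeals

/-! ### The flatness criterion for ideals of an algebra over the base -/

section NilpotentAlgebra

variable {A R : Type*} [CommRing A] [CommRing R] [Algebra A R]

theorem Ideal.restrictScalars_inf_smul_top_le_iff (m : Ideal A) (Z : Ideal R) :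
    Z.restrictScalars A ⊓ m • ⊤ ≤ m • Z.restrictScalars A ↔
      Z ⊓ m.map (algebraMap A R) ≤ m.map (algebraMap A R) • Z := by
  rw [← Ideal.smul_restrictScalars, ← Submodule.restrictScalars_top A R R,
    ← Ideal.smul_restrictScalars, smul_eq_mul, smul_eq_mul, Ideal.mul_top]
  exact Iff.rfl

theorem Ideal.flat_quotient_iff {m : Ideal A} [m.IsMaximal] (hm : IsNilpotent m)
    [Module.Projective A R] (Z : Ideal R) :
    Module.Flat A (R ⧸ Z) ↔ Z ⊓ m.map (algebraMap A R) ≤ m.map (algebraMap A R) • Z := by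
  rw [← restrictScalars_inf_smul_top_le_iff]
  refine ⟨fun h => ?_, fun h => ?_⟩
  · have : Module.Flat A (R ⧸ Z.restrictScalars A) := h
    exact Submodule.inf_smul_top_le_of_flat m
  · have := Module.Flat.quotient_of_inf_smul_top_le hm h
    exact .of_linearEquiv (Submodule.Quotient.restrictScalarsEquiv A Z).symm

/-- Only `R` needs to be projective over `A`; `M` acquires its `A`-structure through `R`, after
which `LinearMap.ker_inf_smul_top_le` applies to `f` as an `A`-linear map. -/
theorem LinearMap.ker_inf_map_smul_top_le {M : Type*} [AddCommGroup M] [Module R M]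
    {m : Ideal A} [m.IsMaximal] (hm : IsNilpotent m) [Module.Projective A R] (f : M →ₗ[R] R)
    (h : range f ⊓ m.map (algebraMap A R) ≤ m.map (algebraMap A R) • range f) :
    ker f ⊓ m.map (algebraMap A R) • ⊤ ≤ m.map (algebraMap A R) • ker f := by
  let _ : Module A M := Module.compHom M (algebraMap A R)
  have : IsScalarTower A R M := ⟨fun a r x => by
    rw [Algebra.smul_def, mul_smul]; rfl⟩
  have := LinearMap.ker_inf_smul_top_le hm (f.restrictScalars A)
    ((Ideal.restrictScalars_inf_smul_top_le_iff m (range f)).2 h)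
  intro x hx
  have h1 : x ∈ m • (ker f).restrictScalars A := this ⟨hx.1, by
    rw [← Submodule.restrictScalars_top A R M, ← Ideal.smul_restrictScalars]
    exact hx.2⟩
  rwa [← Ideal.smul_restrictScalars] at h1

end NilpotentAlgebra

/-! ### Lifting kernels modulo an ideal -/

section KernelsModuloIdeals

variable {R M M' : Type*} [CommRing R] [AddCommGroup M] [Module R M] [AddCommGroup M'] [Module R M']
  {n : Ideal R} {f : M →ₗ[R] R}

/-- If the kernel of the reduction of `f` lifts to the kernel of `f`, then `f` has a "flat"
cokernel. -/
lemma LinearMap.range_inf_le_of_ker_lifts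
    (h : ∀ x, f x ∈ n → ∃ x', f x' = 0 ∧ x - x' ∈ n • (⊤ : Submodule R M)) :
    range f ⊓ n ≤ n • range f := by
  rintro _ ⟨⟨x, rfl⟩, hx⟩
  obtain ⟨x', hx', hxx'⟩ := h x hx
  have h1 : f x = f (x - x') := by rw [map_sub, hx', sub_zero]
  rw [h1, ← Submodule.map_top, ← Submodule.map_smul'']
  exact ⟨_, hxx', rfl⟩

lemma LinearMap.ker_lifts_of_range_inf_le (h : range f ⊓ n ≤ n • range f) (x : M)
    (hx : f x ∈ n) : ∃ x', f x' = 0 ∧ x - x' ∈ n • (⊤ : Submodule R M) := by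
  have h1 : f x ∈ n • range f := h ⟨⟨x, rfl⟩, hx⟩
  rw [← Submodule.map_top, ← Submodule.map_smul''] at h1
  obtain ⟨y, hy, hxy⟩ := h1
  exact ⟨x - y, by rw [map_sub, hxy, sub_self], by rwa [sub_sub_cancel]⟩

/-- Nakayama for `ker f` against `range g`: an element of `ker f` differs from some `g w` by an
element of `ker f ∩ n M`, hence of `n ker f`. -/
lemma LinearMap.ker_le_range_of_isNilpotent (hn : IsNilpotent n) (g : M' →ₗ[R] M)
    (hf : ker f ⊓ n • ⊤ ≤ n • ker f) (hg : ∀ w, f (g w) = 0)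
    (hs : ∀ x, f x = 0 → ∃ w, x - g w ∈ n • (⊤ : Submodule R M)) : ker f ≤ range g := by
  refine Submodule.le_of_le_sup_smul_of_isNilpotent hn fun x hx => ?_
  obtain ⟨w, hw⟩ := hs x hx
  have : x - g w ∈ n • ker f := hf ⟨by
    change f (x - g w) = 0
    rw [map_sub, hg, sub_zero]; exact hx, hw⟩
  rw [← add_sub_cancel (g w) x]
  exact Submodule.add_mem_sup ⟨w, rfl⟩ this

end KernelsModuloIdeals

/-! ### Coordinates on `J ⊗ M` with respect to a basis of `J` -/

section TensorCoordinates

variable {k J M M' : Type*} [Field k] [AddCommGroup J] [Module k J] [AddCommGroup M] [Module k M]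
  [AddCommGroup M'] [Module k M']

/-- The map `J ⊗ M → M` given by a linear form on `J`. -/
noncomputable def tensorCoord (l : J →ₗ[k] k) (M : Type*) [AddCommGroup M] [Module k M] :
    J ⊗[k] M →ₗ[k] M :=
  (TensorProduct.lid k M).toLinearMap ∘ₗ l.rTensor M

@[simp] lemma tensorCoord_tmul (l : J →ₗ[k] k) (j : J) (m : M) :
    tensorCoord l M (j ⊗ₜ m) = l j • m := by simp [tensorCoord]

lemma tensorCoord_lTensor (l : J →ₗ[k] k) (f : M →ₗ[k] M') (t : J ⊗[k] M) :
    tensorCoord l M' (f.lTensor J t) = f (tensorCoord l M t) := by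
  induction t using TensorProduct.induction_on with
  | zero => simp
  | tmul j m => simp
  | add x y hx hy => rw [map_add, map_add, map_add, map_add, hx, hy]

lemma rTensor_lTensor_comm {J' : Type*} [AddCommGroup J'] [Module k J'] (f : J →ₗ[k] J')
    (g : M →ₗ[k] M') (t : J ⊗[k] M) :
    f.rTensor M' (g.lTensor J t) = g.lTensor J' (f.rTensor M t) := by
  rw [← LinearMap.comp_apply, ← LinearMap.comp_apply, LinearMap.rTensor_comp_lTensor,
    LinearMap.lTensor_comp_rTensor]

lemma sum_basis_tmul_tensorCoord {ι : Type*} [Fintype ι] (b : Module.Basis ι k J)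
    (t : J ⊗[k] M) : ∑ i, b i ⊗ₜ tensorCoord (b.coord i) M t = t := by
  induction t using TensorProduct.induction_on with
  | zero => simp
  | tmul j m =>
    simp only [tensorCoord_tmul, TensorProduct.tmul_smul]
    simp only [TensorProduct.smul_tmul', ← TensorProduct.sum_tmul, Module.Basis.coord_apply,
      b.sum_repr]
  | add x y hx hy =>
    simp only [map_add, TensorProduct.tmul_add, Finset.sum_add_distrib, hx, hy]

lemma tensorCoord_ext {ι : Type*} [Fintype ι] (b : Module.Basis ι k J) {t t' : J ⊗[k] M}
    (h : ∀ i, tensorCoord (b.coord i) M t = tensorCoord (b.coord i) M t') : t = t' := by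
  rw [← sum_basis_tmul_tensorCoord b t, ← sum_basis_tmul_tensorCoord b t']
  simp only [h]

lemma exists_tensorCoord_eq {ι : Type*} [Fintype ι] (b : Module.Basis ι k J)
    (c : ι → M) : ∃ t : J ⊗[k] M, ∀ i, tensorCoord (b.coord i) M t = c i := by
  classical
  refine ⟨∑ i, b i ⊗ₜ c i, fun i => ?_⟩
  simp [map_sum, Finsupp.single_apply]

end TensorCoordinates

/-! ### Factorization through a surjection, and the kernel of a connecting map -/

/-- A linear map which kills the kernel of a surjective map factors through it. -/
lemma LinearMap.exists_factor_of_ker_le {k X Y Z : Type*} [Field k] [AddCommGroup X] [Module k X]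
    [AddCommGroup Y] [Module k Y] [AddCommGroup Z] [Module k Z] (a : X →ₗ[k] Y) (b : X →ₗ[k] Z)
    (ha : Function.Surjective a) (h : ∀ x, a x = 0 → b x = 0) :
    ∃ c : Y →ₗ[k] Z, ∀ x, c (a x) = b x := by
  obtain ⟨s, hs⟩ := a.exists_rightInverse_of_surjective (LinearMap.range_eq_top.2 ha)
  refine ⟨b ∘ₗ s, fun x => ?_⟩
  have h1 := h (s (a x) - x) (by
    rw [map_sub, sub_eq_zero]; exact LinearMap.congr_fun hs (a x))
  rwa [map_sub, sub_eq_zero] at h1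

/-- This is exactness of the contravariant long `Ext` sequence at `Hom(S.X₁, Y)`. -/
lemma CategoryTheory.ShortComplex.ShortExact.extClass_comp_mk₀_eq_zero_iff {C : Type*} [Category C]
    [Abelian C] [HasExt.{v} C] {S : ShortComplex C} (hS : S.ShortExact) {Y : C} (ψ : S.X₁ ⟶ Y) :
    hS.extClass.comp (Abelian.Ext.mk₀ ψ) (add_zero 1) = 0 ↔ ∃ φ : S.X₂ ⟶ Y, S.f ≫ φ = ψ := by
  constructor
  · intro h
    obtain ⟨x, hx⟩ := Abelian.Ext.contravariant_sequence_exact₁ hS _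
      (Abelian.Ext.mk₀ ψ) (add_zero 1) h
    obtain ⟨φ, rfl⟩ := (Abelian.Ext.mk₀_bijective _ _).2 x
    refine ⟨φ, (Abelian.Ext.mk₀_bijective _ _).1 ?_⟩
    rw [← hx, Abelian.Ext.mk₀_comp_mk₀]
  · rintro ⟨φ, rfl⟩
    rw [← Abelian.Ext.mk₀_comp_mk₀, ← Abelian.Ext.comp_assoc_of_second_deg_zero, hS.extClass_comp,
      Abelian.Ext.zero_comp]

/-! ### Complete reducibility, equivariant lifting and finiteness of multiplicities -/

namespace AlgGroup

open scoped MonoidAlgebra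

variable {k G : Type u} [Field k] [Group G] {𝒢 : AlgGroup k G}
variable {V W X : Type u} [AddCommGroup V] [Module k V] [AddCommGroup W] [Module k W]
  [AddCommGroup X] [Module k X]
  {ρ : Representation k G V} {σ : Representation k G W} {τ : Representation k G X}

/-- A regular map is a finite sum of maps `f · w`, so its values stay in the span of finitely many
`w`. This is the source of local finiteness. -/
lemma exists_fg_of_mem_regularMaps {F : G → V} (hF : F ∈ 𝒢.regularMaps V) :
    ∃ S : Submodule k V, S.FG ∧ ∀ g, F g ∈ S := by
  induction hF using Submodule.span_induction with
  | mem F hF =>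
    obtain ⟨f, -, w, rfl⟩ := hF
    exact ⟨k ∙ w, Submodule.fg_span_singleton w,
      fun g => Submodule.smul_mem _ _ (Submodule.mem_span_singleton_self w)⟩
  | zero => exact ⟨⊥, Submodule.fg_bot, fun g => zero_mem _⟩
  | add F F' _ _ h h' =>
    obtain ⟨S, hS, h⟩ := h
    obtain ⟨S', hS', h'⟩ := h'
    exact ⟨S ⊔ S', hS.sup hS', fun g => Submodule.add_mem_sup (h g) (h' g)⟩
  | smul c F _ h =>
    obtain ⟨S, hS, h⟩ := h
    exact ⟨S, hS, fun g => S.smul_mem c (h g)⟩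

lemma IsRational.subrep (h : 𝒢.IsRational ρ) (S : Subrepresentation ρ) :
    𝒢.IsRational S.toRepresentation :=
  .of_injective S.toSubmodule.subtype Subtype.val_injective (fun _ _ => rfl) h

/-- Rational representations are locally finite. -/
lemma IsRational.exists_finiteDimensional_subrep (h : 𝒢.IsRational ρ) (v : V) :
    ∃ S : Subrepresentation ρ, v ∈ S.toSubmodule ∧ FiniteDimensional k S.toSubmodule := by
  obtain ⟨S, hS, hv⟩ := exists_fg_of_mem_regularMaps (h v)
  refine ⟨⟨Submodule.span k (Set.range fun g => ρ g v), fun g w hw => ?_⟩,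
    Submodule.subset_span ⟨1, by simp⟩, ?_⟩
  · have : Submodule.span k (Set.range fun g => ρ g v) ≤
        (Submodule.span k (Set.range fun g => ρ g v)).comap (ρ g) := by
      refine Submodule.span_le.2 ?_
      rintro _ ⟨x, rfl⟩
      exact Submodule.subset_span ⟨g * x, by simp⟩
    exact this hw
  · have := Module.Finite.iff_fg.2 hS
    exact Submodule.finiteDimensional_of_le (S₂ := S)
      (Submodule.span_le.2 (by rintro _ ⟨x, rfl⟩; exact hv x))

/-- The inclusion of a subrepresentation, as a map of modules over the group algebra. -/
def subrepIncl (S : Subrepresentation ρ) : S.toRepresentation.asModule →ₗ[k[G]] ρ.asModule :=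
  let val : S.toRepresentation.asModule →+ ρ.asModule := S.toSubmodule.subtype.toAddMonoidHom
  { val with
    map_smul' := fun c x => by
      change val (c • x) = c • val x
      induction c using MonoidAlgebra.induction_linear with
      | zero => rw [zero_smul, zero_smul, map_zero]
      | add a b ha hb => rw [add_smul, add_smul, map_add, ha, hb]
      | single g a =>
        rw [Representation.single_smul, Representation.single_smul]
        rfl }

/-- Rational representations of a reductive group are completely reducible. -/
theorem IsReductive.isSemisimpleRepresentation (h𝒢 : 𝒢.IsReductive) (h : 𝒢.IsRational ρ) :
    ρ.IsSemisimpleRepresentation := by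
  rw [Representation.isSemisimpleRepresentation_iff_isSemisimpleModule_asModule]
  -- The representation is the sum of its finite-dimensional subrepresentations, each semisimple by
  -- reductivity.
  choose S hS hf using h.exists_finiteDimensional_subrep
  refine isSemisimpleModule_of_isSemisimpleModule_submodule' (p := fun v => (S v).asSubmodule)
    (fun v => ?_) ?_
  · have := hf v
    have := h𝒢 _ _ (h.subrep (S v))
    rw [Representation.isSemisimpleRepresentation_iff_isSemisimpleModule_asModule] at this
    have e := LinearEquiv.ofInjective (subrepIncl (S v)) Subtype.val_injective
    have hr : LinearMap.range (subrepIncl (S v)) = (S v).asSubmodule :=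
      SetLike.coe_injective (Subtype.range_coe (s := (S v : Set V)))
    rw [← hr]
    exact .congr e.symm
  · rw [eq_top_iff]
    exact fun v _ => (le_iSup (fun v => (S v).asSubmodule) v) (hS v)

/-- Equivariant maps lift along equivariant maps of rational representations of a reductive
group. -/
theorem IsReductive.exists_lift (h𝒢 : 𝒢.IsReductive) (hρ : 𝒢.IsRational ρ)
    (f : V →ₗ[k] W) (hf : ∀ g v, f (ρ g v) = σ g (f v))
    (h : X →ₗ[k] W) (hh : ∀ g x, h (τ g x) = σ g (h x)) (hr : ∀ x, ∃ v, f v = h x) :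
    ∃ l : X →ₗ[k] V, (∀ g x, l (τ g x) = ρ g (l x)) ∧ ∀ x, f (l x) = h x := by
  have := h𝒢.isSemisimpleRepresentation hρ
  let K : Subrepresentation ρ := ⟨LinearMap.ker f, fun g v hv => by
    rw [LinearMap.mem_ker] at hv ⊢; rw [hf, hv, map_zero]⟩
  obtain ⟨C, hC⟩ := exists_isCompl K
  have hdis : Disjoint (LinearMap.ker f) C.toSubmodule := by
    rw [Submodule.disjoint_def]
    intro x hx hx'
    have : x ∈ (K ⊓ C).toSubmodule := ⟨hx, hx'⟩
    rw [hC.inf_eq_bot] at this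
    exact this
  have hcod (w : V) : ∃ c ∈ C.toSubmodule, f c = f w := by
    have : w ∈ (K ⊔ C).toSubmodule := by rw [hC.sup_eq_top]; trivial
    obtain ⟨a, ha, c, hc, rfl⟩ := Submodule.mem_sup.1 this
    exact ⟨c, hc, by rw [map_add, LinearMap.mem_ker.1 ha, zero_add]⟩
  have hinj : Function.Injective (f ∘ₗ C.toSubmodule.subtype) := by
    rw [← LinearMap.ker_eq_bot, eq_bot_iff]
    intro x hx
    exact Subtype.ext ((Submodule.disjoint_def.1 hdis) x.1 hx x.2)
  -- The stable complement `C` of `ker f` maps isomorphically onto the range of `f`. Outside this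
  -- range `s` is an arbitrary linear extension of the inverse, but `h` takes values in the range,
  -- and there stability of `C` gives equivariance.
  obtain ⟨s, hs⟩ := (f ∘ₗ C.toSubmodule.subtype).exists_leftInverse_of_injective
    (LinearMap.ker_eq_bot.2 hinj)
  have hs' (c : C.toSubmodule) : s (f c) = c := LinearMap.congr_fun hs c
  have hl (x : X) : f (s (h x)) = h x := by
    obtain ⟨v, hv⟩ := hr x
    obtain ⟨c, hc, hcv⟩ := hcod v
    have := hs' ⟨c, hc⟩
    rw [← hv, ← hcv, this]
  refine ⟨C.toSubmodule.subtype ∘ₗ s ∘ₗ h, fun g x => ?_, hl⟩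
  have h1 := hs' ⟨_, C.apply_mem_toSubmodule g (s (h x)).2⟩
  rw [hf, hl] at h1
  exact congrArg Subtype.val ((congrArg s (hh g x)).trans h1)

/-- Variant of `AlgGroup.IsReductive.exists_lift` for lifts with values in a stable subspace. -/
theorem IsReductive.exists_lift_mem (h𝒢 : 𝒢.IsReductive) (hρ : 𝒢.IsRational ρ)
    (S : Submodule k V) (hS : ∀ g, ∀ v ∈ S, ρ g v ∈ S)
    (f : V →ₗ[k] W) (hf : ∀ g v, f (ρ g v) = σ g (f v))
    (h : X →ₗ[k] W) (hh : ∀ g x, h (τ g x) = σ g (h x)) (hr : ∀ x, ∃ v ∈ S, f v = h x) :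
    ∃ l : X →ₗ[k] V, (∀ g x, l (τ g x) = ρ g (l x)) ∧ (∀ x, l x ∈ S) ∧ ∀ x, f (l x) = h x := by
  let S' : Subrepresentation ρ := ⟨S, fun g v hv => hS g v hv⟩
  obtain ⟨l, hl, hl'⟩ := h𝒢.exists_lift (hρ.subrep S') (f ∘ₗ S.subtype)
    (fun g v => hf g v.1) h hh (fun x => by
      obtain ⟨v, hv, hvx⟩ := hr x
      exact ⟨⟨v, hv⟩, hvx⟩)
  exact ⟨S.subtype ∘ₗ l, fun g x => congrArg Subtype.val (hl g x), fun x => (l x).2, hl'⟩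

/-- Restriction of intertwining maps to two subrepresentations. -/
def restrictPair (S C : Subrepresentation ρ) : ρ.IntertwiningMap σ →ₗ[k]
    S.toRepresentation.IntertwiningMap σ × C.toRepresentation.IntertwiningMap σ where
  toFun f := (⟨f.toLinearMap ∘ₗ S.toSubmodule.subtype, fun g => by
      ext x; exact Representation.IntertwiningMap.isIntertwining _ _ f g x.1⟩,
    ⟨f.toLinearMap ∘ₗ C.toSubmodule.subtype, fun g => by
      ext x; exact Representation.IntertwiningMap.isIntertwining _ _ f g x.1⟩)
  map_add' _ _ := rfl
  map_smul' _ _ := rfl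

/-- If the multiplicities of all irreducible rational representations in `σ` are finite, then
`Hom^G(ρ, σ)` is finite-dimensional for every finite-dimensional rational `ρ`. -/
theorem IsReductive.finite_intertwiningMap (h𝒢 : 𝒢.IsReductive)
    (hσ : ∀ (M : Type u) [AddCommGroup M] [Module k M] (τ : Representation k G M),
      𝒢.IsRational τ → τ.IsIrreducible → Module.Finite k (τ.IntertwiningMap σ))
    (h : 𝒢.IsRational ρ) [FiniteDimensional k V] : Module.Finite k (ρ.IntertwiningMap σ) := by
  induction hn : Module.finrank k V using Nat.strong_induction_on generalizing V with
  | _ n ih =>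
  subst hn
  by_cases hirr : ρ.IsIrreducible
  · exact hσ V ρ h hirr
  by_cases hV : Subsingleton V
  · have : Subsingleton (ρ.IntertwiningMap σ) := ⟨fun a b => by
      ext x; rw [Subsingleton.elim x 0, map_zero, map_zero]⟩
    infer_instance
  have hss := h𝒢 V ρ h
  have hnt : Nontrivial V := not_subsingleton_iff_nontrivial.1 hV
  -- A nonzero reducible `V` splits into two proper stable summands. An intertwining map is
  -- determined by its restrictions to them, which induction on the dimension controls.
  have hex : ∃ S : Subrepresentation ρ, S ≠ ⊥ ∧ S ≠ ⊤ := by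
    by_contra! hcon
    have : Nontrivial (Subrepresentation ρ) := ⟨⊥, ⊤, fun h =>
      bot_ne_top (congrArg Subrepresentation.toSubmodule h : (⊥ : Submodule k V) = ⊤)⟩
    exact hirr ⟨fun S => or_iff_not_imp_left.2 (hcon S)⟩
  obtain ⟨S, hS, hS'⟩ := hex
  obtain ⟨C, hC⟩ := exists_isCompl S
  have hlt (T : Subrepresentation ρ) (hT : T ≠ ⊤) :
      Module.finrank k T.toSubmodule < Module.finrank k V :=
    Submodule.finrank_lt fun h => hT (Subrepresentation.toSubmodule_injective h)
  have hC' : C ≠ ⊤ := fun h => hS (by simpa [h] using hC.inf_eq_bot)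
  have := ih _ (hlt S hS') (h.subrep S) rfl
  have := ih _ (hlt C hC') (h.subrep C) rfl
  refine Module.Finite.of_injective (restrictPair S C) fun a b hab => ?_
  ext x
  have hx : x ∈ (S ⊔ C).toSubmodule := by rw [hC.sup_eq_top]; trivial
  obtain ⟨s, hs, c, hc, rfl⟩ := Submodule.mem_sup.1 hx
  have h1 := congrArg (fun f => f.1 ⟨s, hs⟩) hab
  have h2 := congrArg (fun f => f.2 ⟨c, hc⟩) hab
  rw [map_add, map_add]
  exact congrArg₂ (· + ·) h1 h2

end AlgGroup

section EquivariantDeformations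

variable {k G : Type u} [Field k] [Group G] {𝒢 : AlgGroup k G}

/-! ### Projectivity of the modules `P ⊗ N` -/

namespace EqMod

section Free

variable (P : GAlg 𝒢) {N : Type u} [AddCommGroup N] [Module k N] {σ : Representation k G N}
  (hσ : 𝒢.IsRational σ)

/-- The inclusion `n ↦ 1 ⊗ n` of the generators of `P ⊗ N`. -/
noncomputable def freeGen : N →ₗ[k] free P σ hσ := TensorProduct.mk k P N 1

lemma freeGen_act (g : G) (n : N) :
    freeGen P hσ (σ g n) = (free P σ hσ).ρ g (freeGen P hσ n) := by
  have h : (P.rep.tprod σ) g ((1 : P) ⊗ₜ n) = (1 : P) ⊗ₜ σ g n := by simp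
  exact h.symm

variable {P}

lemma free_induction {motive : free P σ hσ → Prop}
    (gen : ∀ (q : P) n, motive (q • freeGen P hσ n))
    (add : ∀ x y, motive x → motive y → motive (x + y)) (x : free P σ hσ) : motive x := by
  have key (x : P ⊗[k] N) : motive x := by
    induction x using TensorProduct.induction_on with
    | zero => simpa using! gen 0 0
    | tmul q n =>
      have h : q • ((1 : P) ⊗ₜ[k] n) = q ⊗ₜ n := by simp [TensorProduct.smul_tmul']
      rw [← h]
      exact gen q n
    | add x y hx hy => exact add x y hx hy
  exact key x

lemma free_hom_ext {M : EqMod P} {f g : free P σ hσ ⟶ M}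
    (h : ∀ n, lin f (freeGen P hσ n) = lin g (freeGen P hσ n)) : f = g := by
  ext x
  induction x using free_induction hσ with
  | gen q n => rw [map_smul, map_smul, h]
  | add x y hx hy => rw [map_add, map_add, hx, hy]

/-- The `P`-linear map `P ⊗ N → M` which extends a linear map on `N`. -/
noncomputable def freeLin {M : EqMod P} (f : N →ₗ[k] M) : free P σ hσ →ₗ[P] M :=
  LinearMap.liftBaseChange P f

lemma freeLin_gen {M : EqMod P} (f : N →ₗ[k] M) (n : N) :
    freeLin hσ f (freeGen P hσ n) = f n := by
  have h : LinearMap.liftBaseChange P f ((1 : P) ⊗ₜ[k] n) = f n := by simp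
  exact h

/-- The morphism `P ⊗ N → M` which extends a `G`-equivariant linear map on `N`. -/
noncomputable def freeLift {M : EqMod P} (f : N →ₗ[k] M)
    (hf : ∀ g n, f (σ g n) = M.ρ g (f n)) : free P σ hσ ⟶ M :=
  mkHom (freeLin hσ f) fun g x => by
    induction x using free_induction hσ with
    | gen q n =>
      rw [(free P σ hσ).semilinear, ← freeGen_act, map_smul, map_smul, M.semilinear, freeLin_gen,
        freeLin_gen, hf]
    | add x y hx hy => rw [map_add, map_add, map_add, map_add, hx, hy]

lemma freeLift_gen {M : EqMod P} (f : N →ₗ[k] M) (hf : ∀ g n, f (σ g n) = M.ρ g (f n)) (n : N) :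
    lin (freeLift hσ f hf) (freeGen P hσ n) = f n :=
  freeLin_gen hσ f n

lemma lin_gen_act {M : EqMod P} (f : free P σ hσ ⟶ M) (g : G) (n : N) :
    ((lin f).restrictScalars k ∘ₗ freeGen P hσ) (σ g n) =
      M.ρ g (((lin f).restrictScalars k ∘ₗ freeGen P hσ) n) := by
  simp only [LinearMap.comp_apply, LinearMap.restrictScalars_apply, freeGen_act, lin_comm]

/-- The modules `P ⊗ N` have the lifting property. -/
lemma exists_comp_eq (h𝒢 : 𝒢.IsReductive) {M L : EqMod P} (f : free P σ hσ ⟶ L) (e : M ⟶ L)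
    (h : ∀ n, ∃ m, lin e m = lin f (freeGen P hσ n)) : ∃ l : free P σ hσ ⟶ M, l ≫ e = f := by
  obtain ⟨l, hl, hl'⟩ := h𝒢.exists_lift M.rational ((lin e).restrictScalars k)
    (fun g v => lin_comm e g v) ((lin f).restrictScalars k ∘ₗ freeGen P hσ)
    (lin_gen_act hσ f) h
  refine ⟨freeLift hσ l hl, free_hom_ext hσ fun n => ?_⟩
  rw [lin_comp, LinearMap.comp_apply, freeLift_gen]
  exact hl' n

/-- Complete reducibility lifts the map on the generators equivariantly, and `P`-linear extension
does the rest. -/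
lemma projective_free (h𝒢 : 𝒢.IsReductive) : Projective (free P σ hσ) where
  factors {E X} (f : free P σ hσ ⟶ X) (e : E ⟶ X) _ := exists_comp_eq hσ h𝒢 f e fun _ => surjective_of_epi _

/-- Restriction to the generators. -/
noncomputable def restrictGen (M : EqMod P) :
    (free P σ hσ ⟶ M) →ₗ[k] σ.IntertwiningMap M.ρ where
  toFun f := ⟨(lin f).restrictScalars k ∘ₗ freeGen P hσ, fun g => by
    ext n; exact lin_gen_act hσ f g n⟩
  map_add' _ _ := rfl
  map_smul' _ _ := rfl

lemma restrictGen_injective (M : EqMod P) : Function.Injective (restrictGen hσ M) :=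
  fun _ _ h => free_hom_ext hσ fun n => congrArg (fun a => a n) h

end Free

end EqMod

/-! ### Presentations, `Ext` and the space `N^G` -/

open EqMod

section

variable {P : GAlg 𝒢} {I : Ideal P}

lemma quotientProj_eq_zero_iff (hI : ∀ g, ∀ x ∈ I, P.act g x ∈ I) (x : P) :
    lin (quotientProj P I hI) x = 0 ↔ x ∈ I :=
  Submodule.Quotient.mk_eq_zero I

lemma quotientProj_surjective (hI : ∀ g, ∀ x ∈ I, P.act g x ∈ I) :
    Function.Surjective (lin (quotientProj P I hI)) :=
  Submodule.mkQ_surjective I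

end

namespace EquivariantPresentation

variable {P : GAlg 𝒢} {I : Ideal P} (p : EquivariantPresentation P I)
  (hI : ∀ g, ∀ x ∈ I, P.act g x ∈ I)

/-- The generators of `Q ⊗ N₁`. -/
noncomputable def gen₁ (Q : GAlg 𝒢) : p.N₁.toSubmodule →ₗ[k] p.F₁ Q := freeGen Q _

/-- The generators of `Q ⊗ N₂`. -/
noncomputable def gen₂ (Q : GAlg 𝒢) : p.N₂.toSubmodule →ₗ[k] p.F₂ Q := freeGen Q _

lemma mem_ideal_iff (x : P) : x ∈ I ↔ ∃ y, lin p.u₀ y = x := by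
  exact (Ideal.ext_iff.1 p.range_eq x).symm

lemma exists_v₀_eq (y : p.F₁ P) (hy : lin p.u₀ y = 0) : ∃ w, lin p.v₀ w = y :=
  p.exact.ge hy

lemma u₀_v₀ (w : p.F₂ P) : lin p.u₀ (lin p.v₀ w) = 0 :=
  p.exact.le ⟨w, rfl⟩

lemma toSyzygy_surjective : Function.Surjective (lin p.toSyzygy) := fun y => by
  obtain ⟨w, hw⟩ := p.exists_v₀_eq y.1 y.2
  exact ⟨w, Subtype.ext hw⟩

lemma comp_toSyzygy_injective {M : EqMod P} {a b : p.syzygy ⟶ M}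
    (h : p.toSyzygy ≫ a = p.toSyzygy ≫ b) : a = b :=
  have := epi_of_surjective p.toSyzygy_surjective
  (cancel_epi p.toSyzygy).1 h

/-- The inclusion `K → P ⊗ N₁`. -/
noncomputable def syzygyι : p.syzygy ⟶ p.F₁ P := kerι p.u₀

lemma toSyzygy_syzygyι : p.toSyzygy ≫ p.syzygyι = p.v₀ := rfl

lemma connecting_eq_zero_iff (ψ : p.syzygy ⟶ quotientObj P I hI) :
    p.connecting hI ψ = 0 ↔ ∃ φ : p.F₁ P ⟶ quotientObj P I hI, p.syzygyι ≫ φ = ψ :=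
  (p.syzygySequence_shortExact hI).extClass_comp_mk₀_eq_zero_iff ψ

/-- The cokernel of the connecting map embeds into `Ext¹(P ⊗ N₁, P/I)`, which vanishes by
projectivity. -/
lemma connecting_surjective (h𝒢 : 𝒢.IsReductive) : Function.Surjective (p.connecting hI) := by
  intro x
  have : Projective (p.syzygySequence hI).X₂ := projective_free (rational_subrep _ p.N₁) h𝒢
  obtain ⟨y, hy⟩ := Abelian.Ext.contravariant_sequence_exact₃ (p.syzygySequence_shortExact hI) _
    x (Abelian.Ext.eq_zero_of_projective _) (add_zero 1)
  obtain ⟨ψ, rfl⟩ := (Abelian.Ext.mk₀_bijective _ _).2 y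
  exact ⟨ψ, hy⟩

/-- The lifting property of `P ⊗ N₁` with respect to `P → P / I`. -/
lemma exists_lift_quotientProj₁ (h𝒢 : 𝒢.IsReductive) (φ : p.F₁ P ⟶ quotientObj P I hI) :
    ∃ C, C ≫ quotientProj P I hI = φ :=
  exists_comp_eq _ h𝒢 φ _ fun _ => quotientProj_surjective hI _

/-- The lifting property of `P ⊗ N₂` with respect to `P → P / I`. -/
lemma exists_lift_quotientProj₂ (h𝒢 : 𝒢.IsReductive) (φ : p.F₂ P ⟶ quotientObj P I hI) :
    ∃ C, C ≫ quotientProj P I hI = φ :=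
  exists_comp_eq _ h𝒢 φ _ fun _ => quotientProj_surjective hI _

/-- The values of `C` lie in `I`, the range of `u₀`, which is enough to lift from generators. This
accounts for the summand `u₀ D` of `μ`. -/
lemma exists_comp_u₀ (h𝒢 : 𝒢.IsReductive) (C : p.F₂ P ⟶ self P)
    (hC : C ≫ quotientProj P I hI = 0) : ∃ D, D ≫ p.u₀ = C :=
  exists_comp_eq _ h𝒢 C _ fun n => (p.mem_ideal_iff _).1
    ((quotientProj_eq_zero_iff hI _).1 (congrArg (fun φ => lin φ (p.gen₂ P n)) hC))

lemma mem_range_μ (C : p.F₂ P ⟶ self P) : C ∈ LinearMap.range p.μ ↔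
    ∃ (B : p.F₁ P ⟶ self P) (D : p.F₂ P ⟶ p.F₁ P), p.v₀ ≫ B + D ≫ p.u₀ = C := by
  constructor
  · rintro ⟨⟨B, D⟩, h⟩
    exact ⟨B, D, h⟩
  · rintro ⟨B, D, h⟩
    exact ⟨⟨B, D⟩, h⟩

lemma u₀_quotientProj : p.u₀ ≫ quotientProj P I hI = 0 := by
  ext x
  exact (quotientProj_eq_zero_iff hI _).2 ((p.mem_ideal_iff _).2 ⟨x, rfl⟩)

/-- The embedding of `Ext^{1,G}(I, P / I)` into `N^G`. -/
theorem exists_extOne_embedding (h𝒢 : 𝒢.IsReductive) :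
    ∃ ι : ExtOne P I hI →ₗ[k] p.NG, Function.Injective ι ∧
      ∀ (ψ : p.syzygy ⟶ quotientObj P I hI) (C : p.F₂ P ⟶ self P),
        C ≫ quotientProj P I hI = p.toSyzygy ≫ ψ →
          ι (p.connecting hI ψ) = (LinearMap.range p.μ).mkQ C := by
  -- The class in `N^G` depends only on `C` modulo `I`; `e` is the resulting map on `Hom(P ⊗ N₂,
  -- P/I)`.
  obtain ⟨e, he⟩ := LinearMap.exists_factor_of_ker_le
    (Linear.rightComp k (p.F₂ P) (quotientProj P I hI)) (LinearMap.range p.μ).mkQ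
    (p.exists_lift_quotientProj₂ hI h𝒢) fun C hC => by
      obtain ⟨D, hD⟩ := p.exists_comp_u₀ hI h𝒢 C hC
      exact (Submodule.Quotient.mk_eq_zero _).2 ((p.mem_range_μ _).2 ⟨0, D, by simp [hD]⟩)
  have he' (C : p.F₂ P ⟶ self P) : e (C ≫ quotientProj P I hI) = (LinearMap.range p.μ).mkQ C :=
    he C
  -- Both sides say that `ψ` extends to `P ⊗ N₁`. Reading `C = B v₀ + u₀ D` modulo `I` gives the
  -- extension; conversely, after lifting an extension to `B`, the remainder `C - B v₀` takes values
  -- in `I`.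
  have key (ψ : p.syzygy ⟶ quotientObj P I hI) :
      e (p.toSyzygy ≫ ψ) = 0 ↔ p.connecting hI ψ = 0 := by
    obtain ⟨C, hC⟩ := p.exists_lift_quotientProj₂ hI h𝒢 (p.toSyzygy ≫ ψ)
    rw [connecting_eq_zero_iff, ← hC, he', Submodule.mkQ_apply, Submodule.Quotient.mk_eq_zero,
      mem_range_μ]
    constructor
    · rintro ⟨B, D, rfl⟩
      refine ⟨B ≫ quotientProj P I hI, p.comp_toSyzygy_injective ?_⟩
      rw [← hC, Preadditive.add_comp, Category.assoc, Category.assoc, u₀_quotientProj, comp_zero,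
        add_zero, ← toSyzygy_syzygyι, Category.assoc]
    · rintro ⟨φ, rfl⟩
      obtain ⟨B, rfl⟩ := p.exists_lift_quotientProj₁ hI h𝒢 φ
      obtain ⟨D, hD⟩ := p.exists_comp_u₀ hI h𝒢 (C - p.v₀ ≫ B) (by
        rw [Preadditive.sub_comp, hC, ← toSyzygy_syzygyι]; simp)
      exact ⟨B, D, by rw [hD]; simp⟩
  obtain ⟨ι, hι⟩ := LinearMap.exists_factor_of_ker_le (p.connecting hI)
    (e ∘ₗ Linear.leftComp k (quotientObj P I hI) p.toSyzygy) (p.connecting_surjective hI h𝒢)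
    fun ψ hψ => (key ψ).2 hψ
  refine ⟨ι, ?_, fun ψ C hC => ?_⟩
  · rw [← LinearMap.ker_eq_bot, eq_bot_iff]
    intro x hx
    obtain ⟨ψ, rfl⟩ := p.connecting_surjective hI h𝒢 x
    exact (key ψ).1 ((hι ψ).symm.trans hx)
  · refine (hι ψ).trans ((congrArg e hC.symm).trans (he' C))

section Finite

variable (h𝒢 : 𝒢.IsReductive)
  (hX : ∀ (M : Type u) [AddCommGroup M] [Module k M] (σ : Representation k G M),
    𝒢.IsRational σ → σ.IsIrreducible →
      Module.Finite k (σ.IntertwiningMap (quotientObj P I hI).ρ))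

include p h𝒢 hX

/-- Restriction to the generators embeds this space into `Hom^G(N₂, P/I)`, where the multiplicity
hypothesis applies. -/
theorem finite_hom_quotient : Module.Finite k (p.F₂ P ⟶ quotientObj P I hI) := by
  have := p.finite₂
  have := h𝒢.finite_intertwiningMap hX (rational_subrep _ p.N₂)
  exact Module.Finite.of_injective _ (restrictGen_injective _ _)

theorem finite_extOne : Module.Finite k (ExtOne P I hI) := by
  have := p.finite_hom_quotient hI h𝒢 hX
  have : Module.Finite k (p.syzygy ⟶ quotientObj P I hI) :=
    Module.Finite.of_injective (Linear.leftComp k (quotientObj P I hI) p.toSyzygy)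
      fun _ _ h => p.comp_toSyzygy_injective h
  exact Module.Finite.of_surjective _ (p.connecting_surjective hI h𝒢)

/-- Maps `P ⊗ N₂ → P` with values in `I` die in `N^G`, so `N^G` is a quotient of `Hom(P ⊗ N₂, P/I)`.
-/
theorem finite_NG : Module.Finite k p.NG := by
  have := p.finite_hom_quotient hI h𝒢 hX
  obtain ⟨e, he⟩ := LinearMap.exists_factor_of_ker_le
    (Linear.rightComp k (p.F₂ P) (quotientProj P I hI)) (LinearMap.range p.μ).mkQ
    (p.exists_lift_quotientProj₂ hI h𝒢) fun C hC => by
      obtain ⟨D, hD⟩ := p.exists_comp_u₀ hI h𝒢 C hC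
      exact (Submodule.Quotient.mk_eq_zero _).2 ((p.mem_range_μ _).2 ⟨0, D, by simp [hD]⟩)
  refine Module.Finite.of_surjective e fun x => ?_
  obtain ⟨C, rfl⟩ := Submodule.mkQ_surjective _ x
  exact ⟨_, he C⟩

end Finite

end EquivariantPresentation

/-! ### Functoriality of `Q ⊗ N` in `Q` -/

namespace EqMod

section FreeMap

variable {Q Q' Q'' : GAlg 𝒢} {N : Type u} [AddCommGroup N] [Module k N] {σ : Representation k G N}
  (hσ : 𝒢.IsRational σ)

/-- The map `Q ⊗ N → Q' ⊗ N` induced by a `k`-algebra homomorphism `Q → Q'`. -/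
noncomputable def freeMap (φ : Q →ₐ[k] Q') : free Q σ hσ →ₗ[k] free Q' σ hσ :=
  φ.toLinearMap.rTensor N

lemma freeMap_gen (φ : Q →ₐ[k] Q') (n : N) :
    freeMap hσ φ (freeGen Q hσ n) = freeGen Q' hσ n := by
  have h : φ.toLinearMap.rTensor N ((1 : Q) ⊗ₜ n) = (1 : Q') ⊗ₜ n := by simp
  exact h

lemma freeMap_smul (φ : Q →ₐ[k] Q') (r : Q) (x : free Q σ hσ) :
    freeMap hσ φ (r • x) = φ r • freeMap hσ φ x := by
  have h (x : Q ⊗[k] N) : φ.toLinearMap.rTensor N (r • x) = φ r • φ.toLinearMap.rTensor N x := by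
    induction x using TensorProduct.induction_on with
    | zero => simp
    | tmul q n => simp [TensorProduct.smul_tmul']
    | add x y hx hy => rw [smul_add, map_add, map_add, smul_add, hx, hy]
  exact h x

lemma freeMap_act (φ : Q →ₐ[k] Q') (hφ : ∀ g q, φ (Q.act g q) = Q'.act g (φ q)) (g : G)
    (x : free Q σ hσ) :
    freeMap hσ φ ((free Q σ hσ).ρ g x) = (free Q' σ hσ).ρ g (freeMap hσ φ x) := by
  induction x using free_induction hσ with
  | gen q n =>
    rw [EqMod.semilinear, ← freeGen_act, freeMap_smul, freeMap_smul, EqMod.semilinear, freeMap_gen,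
      freeMap_gen, ← freeGen_act, hφ]
  | add x y hx hy => rw [map_add, map_add, map_add, map_add, hx, hy]

/-- Commutative squares over a homomorphism of `G`-algebras can be checked on generators. -/
lemma square_of_gen (φ : Q →ₐ[k] Q') {M : EqMod Q} {M' : EqMod Q'} (t : M →ₗ[k] M')
    (ht : ∀ (r : Q) m, t (r • m) = φ r • t m) (f : free Q σ hσ ⟶ M) (f' : free Q' σ hσ ⟶ M')
    (h : ∀ n, t (lin f (freeGen Q hσ n)) = lin f' (freeGen Q' hσ n)) (x : free Q σ hσ) :
    t (lin f x) = lin f' (freeMap hσ φ x) := by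
  induction x using free_induction hσ with
  | gen q n => rw [map_smul, ht, freeMap_smul, map_smul, h, freeMap_gen]
  | add x y hx hy => rw [map_add, map_add, map_add, map_add, hx, hy]

lemma freeMap_freeMap (φ : Q →ₐ[k] Q') (ψ : Q' →ₐ[k] Q'') (x : free Q σ hσ) :
    freeMap hσ ψ (freeMap hσ φ x) = freeMap hσ (ψ.comp φ) x := by
  induction x using free_induction hσ with
  | gen q n => rw [freeMap_smul, freeMap_smul, freeMap_smul, freeMap_gen, freeMap_gen, freeMap_gen]; rfl
  | add x y hx hy => rw [map_add, map_add, map_add, hx, hy]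

lemma freeMap_surjective {φ : Q →ₐ[k] Q'} (hφ : Function.Surjective φ) :
    Function.Surjective (freeMap hσ φ) :=
  LinearMap.rTensor_surjective N hφ

/-- Exactness of the tensor product identifies the kernel with the image of `ker φ ⊗ N`, and `r ⊗ n
= r • (1 ⊗ n)`. -/
lemma freeMap_eq_zero_iff {φ : Q →ₐ[k] Q'} (hφ : Function.Surjective φ) (x : free Q σ hσ) :
    freeMap hσ φ x = 0 ↔ x ∈ RingHom.ker φ • (⊤ : Submodule Q (free Q σ hσ)) := by
  constructor
  · intro h
    let i : RingHom.ker φ →ₗ[k] Q := ((RingHom.ker φ).subtype).restrictScalars k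
    have hex : Function.Exact i φ.toLinearMap := fun y =>
      ⟨fun hy => ⟨⟨y, hy⟩, rfl⟩, by rintro ⟨z, rfl⟩; exact z.2⟩
    obtain ⟨t, rfl⟩ := (rTensor_exact N hex hφ x).1 h
    have key (t : RingHom.ker φ ⊗[k] N) :
        i.rTensor N t ∈ RingHom.ker φ • (⊤ : Submodule Q (Q ⊗[k] N)) := by
      induction t using TensorProduct.induction_on with
      | zero => rw [map_zero]; exact zero_mem _
      | tmul r n =>
        have h1 : i.rTensor N (r ⊗ₜ n) = (r : Q) • ((1 : Q) ⊗ₜ[k] n) := by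
          simp [TensorProduct.smul_tmul', i]
        rw [h1]
        exact Submodule.smul_mem_smul r.2 Submodule.mem_top
      | add x y hx hy => rw [map_add]; exact add_mem hx hy
    exact key t
  · intro h
    refine Submodule.smul_induction_on h (fun r hr n _ => ?_) fun x y hx hy => ?_
    · rw [freeMap_smul, (show φ r = 0 from hr), zero_smul]
    · rw [map_add, hx, hy, add_zero]

end FreeMap

end EqMod

/-! ### The algebra `P_A` and its reduction to `P` -/

section BaseChange

variable {P : GAlg 𝒢}

noncomputable instance (A : Type u) [CommRing A] [Algebra k A] : Algebra A (P.baseChange A) :=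
  inferInstanceAs (Algebra A (A ⊗[k] P))

instance (A : Type u) [CommRing A] [Algebra k A] : Module.Free A (P.baseChange A) :=
  inferInstanceAs (Module.Free A (A ⊗[k] P))

lemma Art.isNilpotent_maximalIdeal (A : Art k) : IsNilpotent (IsLocalRing.maximalIdeal A) := by
  have : IsArtinianRing A := A.property.2.1
  rw [← IsLocalRing.jacobson_eq_maximalIdeal (⊥ : Ideal A) bot_ne_top]
  exact IsArtinianRing.isNilpotent_jacobson_bot

/-- The pure tensor `a ⊗ q` of `P_A`. -/
def GAlg.pure (P : GAlg 𝒢) {A : Type u} [CommRing A] [Algebra k A] (a : A) (q : P) :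
    P.baseChange A := (a ⊗ₜ q : A ⊗[k] P)

@[elab_as_elim]
lemma baseChange_induction {A : Type u} [CommRing A] [Algebra k A]
    {motive : P.baseChange A → Prop}
    (pure : ∀ a q, motive (P.pure a q))
    (add : ∀ x y, motive x → motive y → motive (x + y)) (x : P.baseChange A) : motive x := by
  have key (x : A ⊗[k] P) : motive x := by
    induction x using TensorProduct.induction_on with
    | zero =>
      have h : P.pure (0 : A) 0 = 0 := TensorProduct.tmul_zero P (0 : A)
      exact h ▸ pure 0 0
    | tmul a q => exact pure a q
    | add x y hx hy => exact add x y hx hy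
  exact key x

lemma specialize_pure (A : Art k) (a : A) (q : P) :
    P.specialize A (P.pure a q) = algebraMap k P (A.aug a) * q := rfl

lemma act_pure {A : Type u} [CommRing A] [Algebra k A] (g : G) (a : A) (q : P) :
    (P.baseChange A).act g (P.pure a q) = P.pure a (P.act g q) := rfl

lemma pure_mul_pure {A : Type u} [CommRing A] [Algebra k A] (a b : A) (q r : P) :
    P.pure a q * P.pure b r = P.pure (a * b) (q * r) :=
  Algebra.TensorProduct.tmul_mul_tmul a b q r

lemma algebraMap_baseChange {A : Type u} [CommRing A] [Algebra k A] (a : A) :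
    algebraMap A (P.baseChange A) a = P.pure a 1 := rfl

lemma specialize_surjective (A : Art k) : Function.Surjective (P.specialize A) := fun q =>
  ⟨P.pure 1 q, by rw [specialize_pure]; simp⟩

lemma specialize_act (A : Art k) (g : G) (x : P.baseChange A) :
    P.specialize A ((P.baseChange A).act g x) = P.act g (P.specialize A x) := by
  induction x using baseChange_induction with
  | pure a q => rw [act_pure, specialize_pure, specialize_pure]; simp
  | add x y hx hy => rw [map_add, map_add, map_add, map_add, hx, hy]

lemma ker_specialize (A : Art k) : RingHom.ker (P.specialize A) =
    (IsLocalRing.maximalIdeal A).map (algebraMap A (P.baseChange A)) := by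
  apply le_antisymm
  · have key (x : P.baseChange A) : x - P.pure 1 (P.specialize A x) ∈
        (IsLocalRing.maximalIdeal A).map (algebraMap A (P.baseChange A)) := by
      induction x using baseChange_induction with
      | pure a q =>
        have h1 : P.pure 1 (algebraMap k P (A.aug a) * q) = P.pure (algebraMap k A (A.aug a)) q := by
          rw [← Algebra.smul_def, Algebra.algebraMap_eq_smul_one]
          exact (TensorProduct.smul_tmul (A.aug a) (1 : A) q).symm
        have h2 (b c : A) : P.pure b q - P.pure c q = P.pure (b - c) q :=
          (TensorProduct.sub_tmul b c q).symm
        have h3 (b : A) : P.pure b q = P.pure 1 q * algebraMap A (P.baseChange A) b := by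
          rw [algebraMap_baseChange, pure_mul_pure, one_mul, mul_one]
        rw [specialize_pure, h1, h2, h3]
        refine Ideal.mul_mem_left _ _ (Ideal.mem_map_of_mem _ ?_)
        rw [← Art.aug_eq_zero, map_sub, AlgHom.commutes]
        simp
      | add x y hx hy =>
        have h : P.pure 1 (P.specialize A x + P.specialize A y) =
            P.pure 1 (P.specialize A x) + P.pure 1 (P.specialize A y) :=
          TensorProduct.tmul_add (1 : A) _ _
        rw [map_add, h, add_sub_add_comm]
        exact add_mem hx hy
    intro x hx
    have h := key x
    have h0 : P.pure (1 : A) 0 = 0 := TensorProduct.tmul_zero P (1 : A)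
    rwa [(show P.specialize A x = 0 from hx), h0, sub_zero] at h
  · rw [Ideal.map_le_iff_le_comap]
    intro a ha
    change P.specialize A (P.pure a 1) = 0
    rw [specialize_pure, Art.aug_eq_zero.2 ha, map_zero, zero_mul]

lemma isNilpotent_ker_specialize (A : Art k) : IsNilpotent (RingHom.ker (P.specialize A)) := by
  obtain ⟨n, hn⟩ := A.isNilpotent_maximalIdeal
  refine ⟨n, ?_⟩
  rw [ker_specialize, ← Ideal.map_pow, hn]
  exact Ideal.map_bot

lemma flat_iff_inf_ker_specialize_le (A : Art k) (Z : Ideal (P.baseChange A)) :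
    Module.Flat A ((A ⊗[k] P) ⧸ (show Ideal (A ⊗[k] P) from Z)) ↔
      Z ⊓ RingHom.ker (P.specialize A) ≤ RingHom.ker (P.specialize A) • Z := by
  rw [ker_specialize]
  exact Ideal.flat_quotient_iff A.isNilpotent_maximalIdeal (show Ideal (A ⊗[k] P) from Z)

lemma ker_inf_ker_specialize_smul_le (A : Art k) {M : Type u} [AddCommGroup M]
    [Module (P.baseChange A) M] (f : M →ₗ[P.baseChange A] P.baseChange A)
    (h : LinearMap.range f ⊓ RingHom.ker (P.specialize A) ≤
      RingHom.ker (P.specialize A) • LinearMap.range f) :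
    LinearMap.ker f ⊓ RingHom.ker (P.specialize A) • ⊤ ≤
      RingHom.ker (P.specialize A) • LinearMap.ker f := by
  rw [ker_specialize] at h ⊢
  exact LinearMap.ker_inf_map_smul_top_le A.isNilpotent_maximalIdeal f h

end BaseChange

/-! ### Flatness as lifting of relations -/

section Resolutions

variable {P : GAlg 𝒢} {N N' : Type u} [AddCommGroup N] [Module k N] [AddCommGroup N'] [Module k N']
  {σ : Representation k G N} (hσ : 𝒢.IsRational σ) {σ' : Representation k G N'}
  (hσ' : 𝒢.IsRational σ') {A B : Art k}
  {u₀ : free P σ hσ ⟶ self P} {u : free (P.baseChange A) σ hσ ⟶ self (P.baseChange A)}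

lemma specialize_freeMap_reduce (f : A ⟶ B) (x : free (P.baseChange A) σ hσ) :
    freeMap hσ (P.specialize B) (freeMap hσ (P.reduce f) x) = freeMap hσ (P.specialize A) x := by
  rw [freeMap_freeMap, specialize_comp_reduce]

lemma specialize_reduce (f : A ⟶ B) (x : P.baseChange A) :
    P.specialize B (P.reduce f x) = P.specialize A x :=
  DFunLike.congr_fun (specialize_comp_reduce f) x

/-- If `u x` vanishes modulo `m`, then `x` reduces to a relation of `u₀`. Subtracting a lift of that
relation moves `x` into `m F` without changing `u x`. -/
lemma range_inf_ker_specialize_le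
    (hu : ∀ x, P.specialize A (lin u x) = lin u₀ (freeMap hσ (P.specialize A) x))
    (hK : ∀ y, lin u₀ y = 0 → ∃ x, lin u x = 0 ∧ freeMap hσ (P.specialize A) x = y) :
    LinearMap.range (lin u) ⊓ RingHom.ker (P.specialize A) ≤
      RingHom.ker (P.specialize A) • LinearMap.range (lin u) := by
  refine LinearMap.range_inf_le_of_ker_lifts (f := lin u) fun x hx => ?_
  obtain ⟨x', hx', h⟩ := hK (freeMap hσ (P.specialize A) x) ((hu x).symm.trans hx)
  exact ⟨x', hx', (freeMap_eq_zero_iff hσ (specialize_surjective A) _).1 (by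
    rw [map_sub, h, sub_self])⟩

/-- Any lift `x` of the relation has `u x` in `m im u = u (m F)`, so a change of `x` within `m F`
kills `u x`. -/
lemma exists_mem_ker_of_flat
    (hu : ∀ x, P.specialize A (lin u x) = lin u₀ (freeMap hσ (P.specialize A) x))
    (hf : LinearMap.range (lin u) ⊓ RingHom.ker (P.specialize A) ≤
      RingHom.ker (P.specialize A) • LinearMap.range (lin u)) (y : free P σ hσ)
    (hy : lin u₀ y = 0) : ∃ x, lin u x = 0 ∧ freeMap hσ (P.specialize A) x = y := by
  obtain ⟨x, rfl⟩ := freeMap_surjective hσ (specialize_surjective A) y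
  obtain ⟨x', hx', h⟩ := LinearMap.ker_lifts_of_range_inf_le (f := lin u) hf x ((hu x).trans hy)
  have h1 := (freeMap_eq_zero_iff hσ (specialize_surjective A) _).2 h
  rw [map_sub, sub_eq_zero] at h1
  exact ⟨x', hx', h1.symm⟩

/-- Relations which lift give a flat deformation. -/
theorem isDeformation_range {I : Ideal P} (hI : LinearMap.range (lin u₀) = I)
    (hu : ∀ x, P.specialize A (lin u x) = lin u₀ (freeMap hσ (P.specialize A) x))
    (hK : ∀ y, lin u₀ y = 0 → ∃ x, lin u x = 0 ∧ freeMap hσ (P.specialize A) x = y) :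
    IsDeformation P I A (LinearMap.range (lin u)) where
  stable g x hx := range_stable u g x hx
  flat := (flat_iff_inf_ker_specialize_le A (LinearMap.range (lin u))).2
    (range_inf_ker_specialize_le hσ hu hK)
  fiber := by
    apply le_antisymm
    · refine Ideal.map_le_iff_le_comap.2 ?_
      rintro _ ⟨x, rfl⟩
      exact hI.le ⟨_, (hu x).symm⟩
    · intro y hy
      obtain ⟨z, rfl⟩ := hI.ge hy
      obtain ⟨x, rfl⟩ := freeMap_surjective hσ (specialize_surjective A) z
      have := Ideal.mem_map_of_mem (P.specialize A) (show lin u x ∈ LinearMap.range (lin u) from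
        ⟨x, rfl⟩)
      rwa [hu] at this

/-- This controls the ambiguity in lifting a syzygy: two lifts in `ker u` differ by an element of `m
ker u`. -/
lemma ker_inf_le (hf : LinearMap.range (lin u) ⊓ RingHom.ker (P.specialize A) ≤
      RingHom.ker (P.specialize A) • LinearMap.range (lin u)) (x : free (P.baseChange A) σ hσ)
    (hx : lin u x = 0) (hx' : freeMap hσ (P.specialize A) x = 0) :
    x ∈ RingHom.ker (P.specialize A) • LinearMap.ker (lin u) :=
  ker_inf_ker_specialize_smul_le A (lin u) hf
    ⟨hx, (freeMap_eq_zero_iff hσ (specialize_surjective A) _).1 hx'⟩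

/-- Exactness modulo `m` suffices: it matches an element of `ker u` with some `v w` up to `m F`,
flatness puts the difference in `m ker u`, and Nakayama concludes. -/
lemma range_eq_ker_of_flat {v₀ : free P σ' hσ' ⟶ free P σ hσ}
    {v : free (P.baseChange A) σ' hσ' ⟶ free (P.baseChange A) σ hσ}
    (hu : ∀ x, P.specialize A (lin u x) = lin u₀ (freeMap hσ (P.specialize A) x))
    (hv : ∀ x, freeMap hσ (P.specialize A) (lin v x) = lin v₀ (freeMap hσ' (P.specialize A) x))
    (h₀ : ∀ y, lin u₀ y = 0 → ∃ w, lin v₀ w = y)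
    (hf : LinearMap.range (lin u) ⊓ RingHom.ker (P.specialize A) ≤
      RingHom.ker (P.specialize A) • LinearMap.range (lin u))
    (huv : ∀ w, lin u (lin v w) = 0) : LinearMap.range (lin v) = LinearMap.ker (lin u) := by
  refine le_antisymm (by rintro _ ⟨w, rfl⟩; exact huv w) ?_
  refine LinearMap.ker_le_range_of_isNilpotent (f := lin u) (isNilpotent_ker_specialize A) (lin v)
    (ker_inf_ker_specialize_smul_le A (lin u) hf) huv fun x hx => ?_
  have h1 : lin u₀ (freeMap hσ (P.specialize A) x) = 0 := by
    rw [← hu]; exact (congrArg (P.specialize A) hx).trans (map_zero _)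
  obtain ⟨w₀, hw₀⟩ := h₀ _ h1
  obtain ⟨w, rfl⟩ := freeMap_surjective hσ' (specialize_surjective A) w₀
  exact ⟨w, (freeMap_eq_zero_iff hσ (specialize_surjective A) _).1 (by
    rw [map_sub, hv, hw₀, sub_self])⟩

end Resolutions

/-! ### Equivariant lifting and extension of scalars for morphisms -/

section Existence

variable {P : GAlg 𝒢} {N : Type u} [AddCommGroup N] [Module k N]
  {σ : Representation k G N} (hσ : 𝒢.IsRational σ)

/-- Morphisms of free modules lift along equivariant homomorphisms of `G`-algebras. -/
lemma exists_lift_of_gen (h𝒢 : 𝒢.IsReductive) {Q Q' : GAlg 𝒢} (φ : Q →ₐ[k] Q') {M : EqMod Q}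
    {M' : EqMod Q'} (S : Submodule Q M) (hS : ∀ g, ∀ m ∈ S, M.ρ g m ∈ S) (t : M →ₗ[k] M')
    (ht : ∀ (r : Q) m, t (r • m) = φ r • t m) (htG : ∀ g m, t (M.ρ g m) = M'.ρ g (t m))
    (f : free Q' σ hσ ⟶ M') (hf : ∀ n, ∃ m ∈ S, t m = lin f (freeGen Q' hσ n)) :
    ∃ f' : free Q σ hσ ⟶ M, (∀ x, lin f' x ∈ S) ∧
      ∀ x, t (lin f' x) = lin f (freeMap hσ φ x) := by
  obtain ⟨l, hl, hlS, hl'⟩ := h𝒢.exists_lift_mem M.rational (S.restrictScalars k) hS t htG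
    ((lin f).restrictScalars k ∘ₗ freeGen Q' hσ) (lin_gen_act hσ f) hf
  refine ⟨freeLift hσ l hl, fun x => ?_, square_of_gen hσ φ t ht _ _ fun n => ?_⟩
  · induction x using free_induction hσ with
    | gen q n => rw [map_smul, freeLift_gen]; exact S.smul_mem q (hlS n)
    | add x y hx hy => rw [map_add]; exact add_mem hx hy
  · rw [freeLift_gen]; exact hl' n

/-- Extension of scalars for morphisms of free modules. -/
lemma exists_extendScalars {Q Q' : GAlg 𝒢} (φ : Q →ₐ[k] Q') {M : EqMod Q}
    {M' : EqMod Q'} (t : M →ₗ[k] M')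
    (ht : ∀ (r : Q) m, t (r • m) = φ r • t m) (htG : ∀ g m, t (M.ρ g m) = M'.ρ g (t m))
    (f : free Q σ hσ ⟶ M) :
    ∃ f' : free Q' σ hσ ⟶ M', ∀ x, t (lin f x) = lin f' (freeMap hσ φ x) := by
  refine ⟨freeLift hσ (t ∘ₗ (lin f).restrictScalars k ∘ₗ freeGen Q hσ) fun g n => ?_,
    square_of_gen hσ φ t ht _ _ fun n => ?_⟩
  · exact (congrArg t (lin_gen_act hσ f g n)).trans (htG g _)
  · rw [freeLift_gen]; rfl

end Existence

/-! ### Presentations of deformations -/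

namespace EquivariantPresentation

variable {P : GAlg 𝒢} {I : Ideal P} (p : EquivariantPresentation P I) {A B : Art k}

/-- A homomorphism of `G`-algebras, as a map of modules. -/
def selfMap {Q Q' : GAlg 𝒢} (φ : Q →ₐ[k] Q') : self Q →ₗ[k] self Q' := φ.toLinearMap

lemma selfMap_smul {Q Q' : GAlg 𝒢} (φ : Q →ₐ[k] Q') (r : Q) (m : self Q) :
    selfMap φ (r • m) = φ r • selfMap φ m := map_mul φ r m

section

variable {p}
variable {Z : Ideal (P.baseChange A)} {u : p.F₁ (P.baseChange A) ⟶ self (P.baseChange A)}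
  {v : p.F₂ (P.baseChange A) ⟶ p.F₁ (P.baseChange A)}

lemma Lifts.comp_eq_zero (h : p.Lifts A Z u v) (w : p.F₂ (P.baseChange A)) :
    lin u (lin v w) = 0 :=
  h.exact.le ⟨w, rfl⟩

lemma Lifts.exists_mem_ker (h : p.Lifts A Z u v) (y : p.F₁ P) (hy : lin p.u₀ y = 0) :
    ∃ x, lin u x = 0 ∧ p.map₁ (P.specialize A) x = y := by
  obtain ⟨w₀, rfl⟩ := p.exists_v₀_eq y hy
  obtain ⟨w, rfl⟩ := freeMap_surjective _ (specialize_surjective A) w₀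
  exact ⟨lin v w, h.comp_eq_zero w, h.specialize_v w⟩

lemma Lifts.range_inf_le (h : p.Lifts A Z u v) :
    LinearMap.range (lin u) ⊓ RingHom.ker (P.specialize A) ≤
      RingHom.ker (P.specialize A) • LinearMap.range (lin u) :=
  range_inf_ker_specialize_le _ h.specialize_u h.exists_mem_ker

/-- Presentations of deformations are stable under base change. -/
theorem Lifts.baseChange (h : p.Lifts A Z u v) (f : A ⟶ B)
    {u' : p.F₁ (P.baseChange B) ⟶ self (P.baseChange B)}
    {v' : p.F₂ (P.baseChange B) ⟶ p.F₁ (P.baseChange B)}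
    (hu : ∀ x, P.reduce f (lin u x) = lin u' (p.map₁ (P.reduce f) x))
    (hv : ∀ x, p.map₁ (P.reduce f) (lin v x) = lin v' (p.map₂ (P.reduce f) x)) :
    p.Lifts B (Z.map (P.reduce f)) u' v' := by
  have hg₁ (n) : p.map₁ (P.reduce f) (p.gen₁ _ n) = p.gen₁ _ n := freeMap_gen _ _ n
  have hg₂ (n) : p.map₂ (P.reduce f) (p.gen₂ _ n) = p.gen₂ _ n := freeMap_gen _ _ n
  have hsu : ∀ x, P.specialize B (lin u' x) = lin p.u₀ (p.map₁ (P.specialize B) x) := by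
    refine square_of_gen _ (P.specialize B) (selfMap (P.specialize B)) (selfMap_smul _) u' p.u₀
      fun n => ?_
    have h1 := h.specialize_u (p.gen₁ _ n)
    have h2 := (specialize_reduce f (lin u (p.gen₁ _ n))).trans h1
    have h3 := congrArg (P.specialize B) ((hu _).trans (congrArg (lin u') (hg₁ n)))
    exact h3.symm.trans (h2.trans (congrArg (lin p.u₀) (freeMap_gen _ _ n)))
  have hsv : ∀ x, p.map₁ (P.specialize B) (lin v' x) = lin p.v₀ (p.map₂ (P.specialize B) x) := by
    refine square_of_gen _ (P.specialize B) (p.map₁ (P.specialize B)) (freeMap_smul _ _) v' p.v₀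
      fun n => ?_
    have h1 := h.specialize_v (p.gen₂ _ n)
    have h2 := (specialize_freeMap_reduce _ f (lin v (p.gen₂ _ n))).trans h1
    have h3 := (congrArg (p.map₁ (P.specialize B)) ((hv _).trans (congrArg (lin v') (hg₂ n))))
    exact h3.symm.trans (h2.trans (congrArg (lin p.v₀) (freeMap_gen _ _ n)))
  -- Together with `u' v' = 0`, lifting of relations is all that has to be transported to `B`;
  -- flatness and exactness follow from it.
  have hK (y : p.F₁ P) (hy : lin p.u₀ y = 0) :
      ∃ x, lin u' x = 0 ∧ p.map₁ (P.specialize B) x = y := by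
    obtain ⟨x, hx, rfl⟩ := h.exists_mem_ker y hy
    refine ⟨p.map₁ (P.reduce f) x, ?_, specialize_freeMap_reduce _ f x⟩
    rw [← hu]
    exact (congrArg _ hx).trans (map_zero (P.reduce f))
  have huv (w) : lin u' (lin v' w) = 0 := by
    have h0 : v' ≫ u' = 0 := free_hom_ext _ fun n => by
      have h1 : lin u' (lin v' (p.gen₂ _ n)) = 0 := by
        rw [← hg₂, ← hv, ← hu]
        exact (congrArg _ (h.comp_eq_zero _)).trans (map_zero (P.reduce f))
      exact h1
    exact congrArg (fun a => lin a w) h0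
  refine ⟨?_, range_eq_ker_of_flat _ _ hsu hsv p.exists_v₀_eq
    (range_inf_ker_specialize_le _ hsu hK) huv, hsu, hsv⟩
  apply le_antisymm
  · rintro _ ⟨x, rfl⟩
    induction x using free_induction (rational_subrep _ p.N₁) with
    | gen q n =>
      let y : P.baseChange B := lin u' (p.gen₁ _ n)
      have h1 : P.reduce f (lin u (p.gen₁ _ n)) = y := (hu _).trans (congrArg (lin u') (hg₁ n))
      have h2 : q * y ∈ Z.map (P.reduce f) :=
        Ideal.mul_mem_left _ q (h1 ▸ Ideal.mem_map_of_mem _ (h.range_eq.le ⟨_, rfl⟩))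
      have h3 : lin u' (q • p.gen₁ _ n) = q * y := (lin u').map_smul q (p.gen₁ _ n)
      exact h3.symm ▸ h2
    | add x y hx hy =>
      have h3 := map_add (lin u') x y
      exact h3.symm ▸ Ideal.add_mem (Z.map (P.reduce f)) hx hy
  · refine Ideal.map_le_iff_le_comap.2 fun z hz => ?_
    obtain ⟨x, rfl⟩ := h.range_eq.ge hz
    exact ⟨_, (hu x).symm⟩

end

/-- Every deformation has a presentation lifting the given one. -/
theorem exists_lifts (h𝒢 : 𝒢.IsReductive) {Z : Ideal (P.baseChange A)}
    (hZ : IsDeformation P I A Z) : ∃ u v, p.Lifts A Z u v := by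
  have hflat := (flat_iff_inf_ker_specialize_le A Z).1 hZ.flat
  obtain ⟨u, huZ, hu⟩ := exists_lift_of_gen (rational_subrep _ p.N₁) h𝒢 (P.specialize A)
    (M := self (P.baseChange A)) (M' := self P) Z hZ.stable (selfMap (P.specialize A))
    (selfMap_smul _) (specialize_act A) p.u₀ fun n => by
      have h1 : lin p.u₀ (p.gen₁ P n) ∈ I := (p.mem_ideal_iff _).2 ⟨_, rfl⟩
      exact (Ideal.mem_map_iff_of_surjective _ (specialize_surjective A)).1 (hZ.fiber.ge h1)
  have hr : LinearMap.range (lin u) = Z := by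
    refine le_antisymm (by rintro _ ⟨x, rfl⟩; exact huZ x) ?_
    let W : Ideal (P.baseChange A) := LinearMap.range (lin u)
    -- Some `u x` has the same reduction in `I` as `z`, and flatness puts the difference in `m Z`.
    have hW : Z ≤ W ⊔ RingHom.ker (P.specialize A) • Z := by
      intro z hz
      have h1 : P.specialize A z ∈ I := hZ.fiber.le (Ideal.mem_map_of_mem _ hz)
      obtain ⟨y, hy⟩ := (p.mem_ideal_iff _).1 h1
      obtain ⟨x, rfl⟩ := freeMap_surjective (rational_subrep _ p.N₁) (specialize_surjective A) y
      let y : P.baseChange A := lin u x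
      have h2 : z - y ∈ RingHom.ker (P.specialize A) • Z := hflat ⟨sub_mem hz (huZ x), by
        change P.specialize A (z - y) = 0
        rw [map_sub, sub_eq_zero]
        exact hy.symm.trans (hu x).symm⟩
      refine Submodule.mem_sup.2 ⟨y, ⟨x, rfl⟩, z - y, h2, add_sub_cancel y z⟩
    exact Submodule.le_of_le_sup_smul_of_isNilpotent (isNilpotent_ker_specialize A) hW
  rw [← hr] at hflat
  -- The lift `v` is sought with values in `ker u`, which maps onto `ker u₀` by flatness.
  obtain ⟨v, hvK, hv⟩ := exists_lift_of_gen (rational_subrep _ p.N₂) h𝒢 (P.specialize A)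
    (M := p.F₁ (P.baseChange A)) (M' := p.F₁ P) (LinearMap.ker (lin u)) (ker_stable u)
    (p.map₁ (P.specialize A)) (freeMap_smul _ _) (freeMap_act _ _ (specialize_act A)) p.v₀
    fun n => exists_mem_ker_of_flat _ hu hflat _ (p.u₀_v₀ _)
  exact ⟨u, v, hr, range_eq_ker_of_flat _ _ hu hv p.exists_v₀_eq hflat hvK, hu, hv⟩

end EquivariantPresentation

/-! ### Small extensions and coordinates on `J ⊗ P` -/

namespace SmallExtension

variable (E : SmallExtension k) {P : GAlg 𝒢}

lemma mem_ker_iff {j : E.total} : j ∈ E.ker ↔ Art.alg E.proj j = 0 := Iff.rfl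

lemma aug_eq_zero {j : E.total} (hj : j ∈ E.ker) : E.total.aug j = 0 := by
  rw [← Art.aug_comp E.proj, AlgHom.comp_apply, E.mem_ker_iff.1 hj, map_zero]

/-- `A'` acts on `J` through its residue field, since `a - aug a` lies in the maximal ideal, which
kills `J`. -/
lemma mul_eq_aug_smul (a : E.total) {j : E.total} (hj : j ∈ E.ker) :
    a * j = E.total.aug a • j := by
  have h : a - algebraMap k E.total (E.total.aug a) ∈ IsLocalRing.maximalIdeal E.total := by
    rw [← Art.aug_eq_zero, map_sub, AlgHom.commutes]
    simp
  have h1 := E.small _ h j hj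
  rw [sub_mul, sub_eq_zero] at h1
  rw [h1, Algebra.smul_def]

/-- Ideal generators of `J` already span it over `k`, as `A'` acts through scalars. -/
instance finite_ker : Module.Finite k E.ker := by
  have : IsArtinianRing E.total := E.total.property.2.1
  have h : (RingHom.ker (Art.alg E.proj)).FG := IsNoetherian.noetherian _
  obtain ⟨S, hS⟩ := h
  rw [Module.Finite.iff_fg]
  refine ⟨S, le_antisymm (Submodule.span_le.2 fun x hx => ?_) fun x hx => ?_⟩
  · exact hS.le (Submodule.subset_span hx)
  · refine Submodule.span_induction (p := fun x _ => x ∈ Submodule.span k (S : Set E.total))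
      (fun x h => Submodule.subset_span h) (zero_mem _) (fun x y _ _ h h' => add_mem h h')
      (fun a x hx h => ?_) (hS.ge hx)
    rw [smul_eq_mul, E.mul_eq_aug_smul a (hS.le hx)]
    exact Submodule.smul_mem _ _ h

/-- The inclusion `J ⊗ P → P_{A'}`. -/
noncomputable def kerTensor (P : GAlg 𝒢) : E.ker ⊗[k] P →ₗ[k] P.baseChange E.total :=
  E.ker.subtype.rTensor P

lemma kerTensor_tmul (j : E.ker) (q : P) : E.kerTensor P (j ⊗ₜ q) = P.pure (j : E.total) q := rfl

lemma mul_pure (r : P.baseChange E.total) {j : E.total} (hj : j ∈ E.ker) (q : P) :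
    r * P.pure j q = P.pure j (P.specialize E.total r * q) := by
  induction r using baseChange_induction with
  | pure a s =>
    rw [pure_mul_pure, E.mul_eq_aug_smul a hj, specialize_pure, mul_assoc, ← Algebra.smul_def]
    exact TensorProduct.smul_tmul (E.total.aug a) j (s * q)
  | add x y hx hy =>
    rw [add_mul, hx, hy, map_add, add_mul]
    exact (TensorProduct.tmul_add j _ _).symm

lemma reduce_surjective : Function.Surjective (P.reduce E.proj) :=
  TensorProduct.map_surjective E.surjective Function.surjective_id

lemma reduce_eq_zero_iff (y : P.baseChange E.total) :
    P.reduce E.proj y = 0 ↔ ∃ t, E.kerTensor P t = y := by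
  have hex : Function.Exact E.ker.subtype (Art.alg E.proj).toLinearMap := fun y =>
    ⟨fun hy => ⟨⟨y, hy⟩, rfl⟩, by rintro ⟨z, rfl⟩; exact z.2⟩
  exact rTensor_exact P hex E.surjective y

/-- The map `P_{A'} → P` given by an extension to `A'` of a linear form on `J`. -/
noncomputable def coordMap (l : E.ker →ₗ[k] k) (P : GAlg 𝒢) : P.baseChange E.total →ₗ[k] P :=
  -- The extension of `l` beyond `J` is arbitrary; the coordinate has intrinsic meaning only on `J ⊗
  -- P`.
  tensorCoord l.exists_extend.choose P

variable (l : E.ker →ₗ[k] k)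

lemma coordMap_pure (a : E.total) (q : P) :
    E.coordMap l P (P.pure a q) = l.exists_extend.choose a • q :=
  tensorCoord_tmul _ a q

lemma coordMap_pure_ker (j : E.ker) (q : P) :
    E.coordMap l P (P.pure (j : E.total) q) = l j • q := by
  rw [coordMap_pure]
  exact congrArg (· • q) (LinearMap.congr_fun l.exists_extend.choose_spec j)

lemma coordMap_kerTensor (t : E.ker ⊗[k] P) :
    E.coordMap l P (E.kerTensor P t) = tensorCoord l P t := by
  induction t using TensorProduct.induction_on with
  | zero => simp
  | tmul j q => rw [kerTensor_tmul, coordMap_pure_ker, tensorCoord_tmul]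
  | add x y hx hy => rw [map_add, map_add, map_add, hx, hy]

lemma coordMap_act (g : G) (y : P.baseChange E.total) :
    E.coordMap l P ((P.baseChange E.total).act g y) = P.act g (E.coordMap l P y) := by
  induction y using baseChange_induction with
  | pure a q => rw [act_pure, coordMap_pure, coordMap_pure, map_smul]
  | add x y hx hy => rw [map_add, map_add, map_add, map_add, hx, hy]

/-- On `J ⊗ P` the ring `P_{A'}` acts through its reduction to `P`. -/
lemma coordMap_mul (r : P.baseChange E.total) {y : P.baseChange E.total}
    (hy : P.reduce E.proj y = 0) :
    E.coordMap l P (r * y) = P.specialize E.total r * E.coordMap l P y := by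
  obtain ⟨t, rfl⟩ := (E.reduce_eq_zero_iff y).1 hy
  clear hy
  induction t using TensorProduct.induction_on with
  | zero => simp
  | tmul j q =>
    rw [kerTensor_tmul, E.mul_pure r j.2, coordMap_pure_ker, coordMap_pure_ker, mul_smul_comm]
  | add x y hx hy => rw [map_add, mul_add, map_add, map_add, mul_add, hx, hy]

lemma eq_sum_pure_coordMap {ι : Type*} [Fintype ι] (b : Module.Basis ι k E.ker)
    {y : P.baseChange E.total} (hy : P.reduce E.proj y = 0) :
    y = ∑ i, P.pure (b i : E.total) (E.coordMap (b.coord i) P y) := by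
  obtain ⟨t, rfl⟩ := (E.reduce_eq_zero_iff y).1 hy
  conv_lhs => rw [← sum_basis_tmul_tensorCoord b t, map_sum]
  simp only [coordMap_kerTensor]
  rfl

lemma kerTensor_kerMap {E' : SmallExtension k} (f : E.Hom E') (t : E.ker ⊗[k] P) :
    E'.kerTensor P (f.kerMap.rTensor P t) = P.reduce f.onTotal (E.kerTensor P t) := by
  induction t using TensorProduct.induction_on with
  | zero => simp
  | tmul j q => rfl
  | add x y hx hy => rw [map_add, map_add, map_add, map_add, hx, hy]

section Free

variable {N : Type u} [AddCommGroup N] [Module k N] {σ : Representation k G N}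
  (hσ : 𝒢.IsRational σ)

/-- A morphism with values in `J ⊗ P` is determined by its coordinates, which are morphisms over
`P`. -/
lemma exists_coordHom (f : free (P.baseChange E.total) σ hσ ⟶ self (P.baseChange E.total))
    (hf : ∀ x, P.reduce E.proj (lin f x) = 0) : ∃ c : free P σ hσ ⟶ self P,
      ∀ x, E.coordMap l P (lin f x) = lin c (freeMap hσ (P.specialize E.total) x) := by
  let L : self (P.baseChange E.total) →ₗ[k] self P := E.coordMap l P
  have hL (r : P.baseChange E.total) (x) : L (r • lin f x) =
    P.specialize E.total r • L (lin f x) := E.coordMap_mul l r (hf x)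
  obtain ⟨c, hc⟩ : ∃ c : free P σ hσ ⟶ self P, ∀ n, lin c (freeGen P hσ n) =
      L (lin f (freeGen _ hσ n)) :=
    ⟨freeLift hσ (L ∘ₗ (lin f).restrictScalars k ∘ₗ freeGen _ hσ) fun g n =>
      (congrArg L (lin_gen_act hσ f g n)).trans (E.coordMap_act l g _), freeLift_gen hσ _ _⟩
  refine ⟨c, fun x => ?_⟩
  change L (lin f x) = _
  induction x using free_induction hσ with
  | gen r n => rw [freeMap_smul, freeMap_gen, (lin f).map_smul, hL, (lin c).map_smul, hc]
  | add x y hx hy => rw [map_add, map_add, map_add, map_add, hx, hy]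

/-- The morphism `j ⊗ C` over `P_{A'}` given by `j ∈ J` and a morphism `C` over `P`. -/
lemma exists_pureHom (j : E.ker) (C : free P σ hσ ⟶ self P) :
    ∃ B : free (P.baseChange E.total) σ hσ ⟶ self (P.baseChange E.total),
      ∀ x, lin B x = P.pure (j : E.total) (lin C (freeMap hσ (P.specialize E.total) x)) := by
  let t : self P →ₗ[k] self (P.baseChange E.total) := TensorProduct.mk k E.total P j
  have ht (r : P.baseChange E.total) (q : self P) : r • t q = t (P.specialize E.total r • q) :=
    E.mul_pure r j.2 q
  obtain ⟨B, hB⟩ : ∃ B : free (P.baseChange E.total) σ hσ ⟶ self (P.baseChange E.total),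
      ∀ n, lin B (freeGen _ hσ n) = t (lin C (freeGen _ hσ n)) :=
    ⟨freeLift hσ (t ∘ₗ (lin C).restrictScalars k ∘ₗ freeGen _ hσ) fun g n =>
      congrArg t (lin_gen_act hσ C g n), freeLift_gen hσ _ _⟩
  refine ⟨B, fun x => ?_⟩
  change _ = t _
  induction x using free_induction hσ with
  | gen r n => rw [freeMap_smul, freeMap_gen, map_smul, map_smul, hB, ht]
  | add x y hx hy => rw [map_add, map_add, map_add, map_add, hx, hy]

end Free

end SmallExtension

/-! ### The obstruction cocycle of a lifted presentation -/

namespace EquivariantPresentation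

variable {P : GAlg 𝒢} {I : Ideal P} (p : EquivariantPresentation P I)
  (hI : ∀ g, ∀ x ∈ I, P.act g x ∈ I) (E : SmallExtension k)

section Maps

variable {Q Q' : GAlg 𝒢} {φ : Q →ₐ[k] Q'}

lemma map₁_smul (r : Q) (x : p.F₁ Q) : p.map₁ φ (r • x) = φ r • p.map₁ φ x :=
  freeMap_smul _ φ r x

lemma map₁_surjective (hφ : Function.Surjective φ) : Function.Surjective (p.map₁ φ) :=
  freeMap_surjective (rational_subrep _ p.N₁) hφ

lemma map₂_surjective (hφ : Function.Surjective φ) : Function.Surjective (p.map₂ φ) :=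
  freeMap_surjective (rational_subrep _ p.N₂) hφ

lemma map₁_eq_zero_iff (hφ : Function.Surjective φ) (x : p.F₁ Q) :
    p.map₁ φ x = 0 ↔ x ∈ RingHom.ker φ • (⊤ : Submodule Q (p.F₁ Q)) :=
  freeMap_eq_zero_iff (rational_subrep _ p.N₁) hφ x

variable {A B : Art k} (f : A ⟶ B)

lemma specialize_map₁_reduce (x : p.F₁ (P.baseChange A)) :
    p.map₁ (P.specialize B) (p.map₁ (P.reduce f) x) = p.map₁ (P.specialize A) x :=
  specialize_freeMap_reduce (rational_subrep _ p.N₁) f x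

lemma specialize_map₂_reduce (x : p.F₂ (P.baseChange A)) :
    p.map₂ (P.specialize B) (p.map₂ (P.reduce f) x) = p.map₂ (P.specialize A) x :=
  specialize_freeMap_reduce (rational_subrep _ p.N₂) f x

end Maps

/-- A presentation of a deformation over the base of a small extension, together with lifts of its
matrices. -/
structure LiftedPresentation (Z : Ideal (P.baseChange E.base)) where
  u : p.F₁ (P.baseChange E.base) ⟶ self (P.baseChange E.base)
  v : p.F₂ (P.baseChange E.base) ⟶ p.F₁ (P.baseChange E.base)
  u' : p.F₁ (P.baseChange E.total) ⟶ self (P.baseChange E.total)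
  v' : p.F₂ (P.baseChange E.total) ⟶ p.F₁ (P.baseChange E.total)
  lifts : p.Lifts E.base Z u v
  reduce_u' : ∀ x, P.reduce E.proj (lin u' x) = lin u (p.map₁ (P.reduce E.proj) x)
  reduce_v' : ∀ x, p.map₁ (P.reduce E.proj) (lin v' x) = lin v (p.map₂ (P.reduce E.proj) x)

theorem exists_liftedPresentation (h𝒢 : 𝒢.IsReductive) {Z : Ideal (P.baseChange E.base)}
    (hZ : IsDeformation P I E.base Z) : Nonempty (p.LiftedPresentation E Z) := by
  obtain ⟨u, v, h⟩ := p.exists_lifts h𝒢 hZ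
  obtain ⟨u', -, hu'⟩ := exists_lift_of_gen (rational_subrep _ p.N₁) h𝒢 (P.reduce E.proj)
    (M := self (P.baseChange E.total)) (M' := self (P.baseChange E.base)) ⊤
    (fun _ _ _ => trivial) (selfMap (P.reduce E.proj)) (selfMap_smul _) (reduce_act _) u
    fun n => by
      obtain ⟨y, hy⟩ := E.reduce_surjective (lin u (p.gen₁ _ n))
      exact ⟨y, trivial, hy⟩
  obtain ⟨v', -, hv'⟩ := exists_lift_of_gen (rational_subrep _ p.N₂) h𝒢 (P.reduce E.proj)
    (M := p.F₁ (P.baseChange E.total)) (M' := p.F₁ (P.baseChange E.base)) ⊤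
    (fun _ _ _ => trivial) (p.map₁ (P.reduce E.proj)) (freeMap_smul _ _)
    (freeMap_act _ _ (reduce_act _)) v fun n => by
      obtain ⟨y, hy⟩ := freeMap_surjective _ E.reduce_surjective (lin v (p.gen₂ _ n))
      exact ⟨y, trivial, hy⟩
  exact ⟨⟨u, v, u', v', h, hu', hv'⟩⟩

namespace LiftedPresentation

variable {p E} {Z : Ideal (P.baseChange E.base)} (X : p.LiftedPresentation E Z)
  (l : E.ker →ₗ[k] k)

/-- The coordinates, modulo `I`, of the values of `u'`. -/
noncomputable def value : p.F₁ (P.baseChange E.total) →ₗ[k] quotientObj P I hI :=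
  let L : self (P.baseChange E.total) →ₗ[k] self P := E.coordMap l P
  (lin (quotientProj P I hI)).restrictScalars k ∘ₗ L ∘ₗ (lin X.u').restrictScalars k

lemma value_eq_zero_iff (x) : X.value hI l x = 0 ↔ E.coordMap l P (lin X.u' x) ∈ I :=
  quotientProj_eq_zero_iff hI _

lemma specialize_u' (x) : P.specialize E.total (lin X.u' x) =
    lin p.u₀ (p.map₁ (P.specialize E.total) x) := by
  have h1 := X.lifts.specialize_u (p.map₁ (P.reduce E.proj) x)
  have h2 := congrArg (P.specialize E.base) (X.reduce_u' x)
  have h3 := specialize_reduce E.proj (lin X.u' x)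
  have h4 := congrArg (lin p.u₀) (p.specialize_map₁_reduce E.proj x)
  exact h3.symm.trans (h2.trans (h1.trans h4))

lemma specialize_v' (w) : p.map₁ (P.specialize E.total) (lin X.v' w) =
    lin p.v₀ (p.map₂ (P.specialize E.total) w) := by
  have h1 := X.lifts.specialize_v (p.map₂ (P.reduce E.proj) w)
  have h2 := congrArg (p.map₁ (P.specialize E.base)) (X.reduce_v' w)
  have h3 := p.specialize_map₁_reduce E.proj (lin X.v' w)
  have h4 := congrArg (lin p.v₀) (p.specialize_map₂_reduce E.proj w)
  exact h3.symm.trans (h2.trans (h1.trans h4))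

lemma reduce_u'_v' (w) : P.reduce E.proj (lin X.u' (lin X.v' w)) = 0 := by
  rw [X.reduce_u']
  exact (congrArg (lin X.u) (X.reduce_v' w)).trans (X.lifts.comp_eq_zero _)

/-- `u'` maps `J ⊗ P ⊗ N₁` to `J ⊗ I`. -/
lemma value_eq_zero_of_map₁_reduce_eq_zero (x) (hx : p.map₁ (P.reduce E.proj) x = 0) :
    X.value hI l x = 0 := by
  have hx' := (p.map₁_eq_zero_iff E.reduce_surjective x).1 hx
  refine Submodule.smul_induction_on hx' (fun r hr m _ => ?_) fun x y hx hy => ?_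
  · rw [value_eq_zero_iff]
    let y : P.baseChange E.total := lin X.u' m
    have h1 : lin X.u' (r • m) = y * r := ((lin X.u').map_smul r m).trans (mul_comm r y)
    have h2 := (congrArg (E.coordMap l P) h1).trans (E.coordMap_mul l y hr)
    have h3 : P.specialize E.total y ∈ I :=
      (p.mem_ideal_iff _).2 ⟨_, (X.specialize_u' m).symm⟩
    exact h2 ▸ Ideal.mul_mem_right _ I h3
  · rw [map_add, hx, hy, add_zero]

/-- The value of `u'` on a lift of a syzygy depends, modulo `I`, only on the reduction of the
syzygy. -/
lemma value_eq_zero (x) (hx : P.reduce E.proj (lin X.u' x) = 0)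
    (hx' : p.map₁ (P.specialize E.total) x = 0) : X.value hI l x = 0 := by
  have h1 : p.map₁ (P.reduce E.proj) x ∈
      RingHom.ker (P.specialize E.base) • LinearMap.ker (lin X.u) :=
    ker_inf_le (rational_subrep _ p.N₁) X.lifts.range_inf_le _ ((X.reduce_u' x).symm.trans hx)
      ((p.specialize_map₁_reduce E.proj x).trans hx')
  -- Over `A` the element is a sum of products `r • m` with `r` zero modulo `𝔪_A` and `m` in `ker
  -- u`. For lifts of `r` and `m`, `u' m` is in `J ⊗ P`, which the lift of `r` kills. So only a
  -- difference in `J ⊗ P ⊗ N₁` remains.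
  obtain ⟨x', h2, h3⟩ : ∃ x', p.map₁ (P.reduce E.proj) x' = p.map₁ (P.reduce E.proj) x ∧
      X.value hI l x' = 0 := by
    refine Submodule.smul_induction_on h1 (fun r hr m hm => ?_) fun x y hx hy => ?_
    · obtain ⟨r, rfl⟩ := E.reduce_surjective r
      obtain ⟨m, rfl⟩ := p.map₁_surjective E.reduce_surjective m
      refine ⟨r • m, p.map₁_smul _ _, ?_⟩
      have h4 : P.specialize E.total r = 0 := (specialize_reduce E.proj r).symm.trans hr
      have h5 := E.coordMap_mul l r ((X.reduce_u' m).trans hm)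
      rw [h4, zero_mul] at h5
      exact (value_eq_zero_iff ..).2 (((congrArg (E.coordMap l P)
        ((lin X.u').map_smul r m)).trans h5) ▸ I.zero_mem)
    · obtain ⟨x', hx', hx''⟩ := hx
      obtain ⟨y', hy', hy''⟩ := hy
      exact ⟨x' + y', by rw [map_add, hx', hy'], by rw [map_add, hx'', hy'', add_zero]⟩
  have h4 := X.value_eq_zero_of_map₁_reduce_eq_zero hI l (x - x') (by rw [map_sub, h2, sub_self])
  rwa [map_sub, h3, sub_zero] at h4

/-- The cocycle `u' v'` modulo `I`, seen as a morphism `K → P / I`. -/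
def IsCocycle (ψ : p.syzygy ⟶ quotientObj P I hI) : Prop :=
  ∀ n, X.value hI l (lin X.v' (p.gen₂ _ n)) = lin ψ (lin p.toSyzygy (p.gen₂ P n))

variable {hI l}

/-- The cocycle is computed by arbitrary lifts of syzygies. -/
lemma IsCocycle.value_eq {ψ : p.syzygy ⟶ quotientObj P I hI} (hψ : X.IsCocycle hI l ψ) (x)
    (hx : P.reduce E.proj (lin X.u' x) = 0) (s : p.syzygy)
    (hs : lin p.syzygyι s = p.map₁ (P.specialize E.total) x) :
    X.value hI l x = lin ψ s := by
  obtain ⟨c, hc⟩ := E.exists_coordHom l (rational_subrep _ p.N₂) (X.v' ≫ X.u') X.reduce_u'_v'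
  have h1 : c ≫ quotientProj P I hI = p.toSyzygy ≫ ψ := free_hom_ext _ fun n => by
    have h2 := hc (p.gen₂ _ n)
    have h3 : lin c (p.gen₂ P n) = E.coordMap l P (lin X.u' (lin X.v' (p.gen₂ _ n))) :=
      (congrArg (lin c) (freeMap_gen _ _ n)).symm.trans h2.symm
    exact (congrArg (lin (quotientProj P I hI)) h3).trans (hψ n)
  obtain ⟨w₀, rfl⟩ := p.toSyzygy_surjective s
  obtain ⟨w, rfl⟩ := p.map₂_surjective (specialize_surjective E.total) w₀
  have h4 : X.value hI l (lin X.v' w) = lin ψ (lin p.toSyzygy (p.map₂ _ w)) :=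
    (congrArg (lin (quotientProj P I hI)) (hc w)).trans
      (congrArg (fun a => lin a (p.map₂ _ w)) h1)
  -- Now `x` and `v' w` have the same reduction in `P ⊗ N₁`, so `value_eq_zero` applies to their
  -- difference.
  rw [← sub_eq_zero]
  refine (congrArg (X.value hI l x - ·) h4).symm.trans ?_
  rw [← map_sub]
  refine X.value_eq_zero hI l _ ?_ ?_
  · exact (congrArg (P.reduce E.proj) (map_sub (lin X.u') _ _)).trans ((map_sub _ _ _).trans
      ((congrArg₂ _ hx (X.reduce_u'_v' w)).trans (sub_zero _)))
  · rw [map_sub, sub_eq_zero, X.specialize_v']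
    exact hs.symm

variable (hI l)

/-- `u' v'` modulo `I` descends to `K`: if `v₀` kills the reduction of `w`, then `v' w` reduces to
zero in `P ⊗ N₁` and `value_eq_zero` applies. -/
theorem exists_isCocycle : ∃ ψ, X.IsCocycle hI l ψ := by
  obtain ⟨c, hc⟩ := E.exists_coordHom l (rational_subrep _ p.N₂) (X.v' ≫ X.u') X.reduce_u'_v'
  have h0 : kerι p.toSyzygy ≫ c ≫ quotientProj P I hI = 0 := by
    ext ⟨w₀, hw₀⟩
    obtain ⟨w, rfl⟩ :=
      p.map₂_surjective (specialize_surjective E.total) w₀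
    have h1 : lin p.v₀ (p.map₂ (P.specialize E.total) w) = 0 := congrArg Subtype.val hw₀
    have h2 := X.value_eq_zero hI l (lin X.v' w) (X.reduce_u'_v' w) ((X.specialize_v' w).trans h1)
    exact (congrArg (lin (quotientProj P I hI)) (hc w)).symm.trans h2
  obtain ⟨ψ, hψ⟩ := CokernelCofork.IsColimit.desc' (isColimitOfExact (kerι_comp p.toSyzygy)
    p.toSyzygy_surjective fun m hm => ⟨⟨m, hm⟩, rfl⟩) _ h0
  have hψ' : p.toSyzygy ≫ ψ = c ≫ quotientProj P I hI := hψ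
  refine ⟨ψ, fun n => ?_⟩
  have h3 : lin c (p.gen₂ P n) = E.coordMap l P (lin X.u' (lin X.v' (p.gen₂ _ n))) :=
    (congrArg (lin c) (freeMap_gen _ _ n)).symm.trans (hc (p.gen₂ _ n)).symm
  exact (congrArg (lin (quotientProj P I hI)) h3).symm.trans
    (congrArg (fun a => lin a (p.gen₂ P n)) hψ').symm

/-- Syzygies lift to `A'` as syzygies modulo `J`. -/
lemma exists_lift_syzygy (s : p.syzygy) : ∃ x, P.reduce E.proj (lin X.u' x) = 0 ∧
    p.map₁ (P.specialize E.total) x = lin p.syzygyι s := by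
  obtain ⟨y, hy, hys⟩ := X.lifts.exists_mem_ker (lin p.syzygyι s) s.2
  obtain ⟨x, rfl⟩ := p.map₁_surjective E.reduce_surjective y
  exact ⟨x, (X.reduce_u' x).trans hy,
    (p.specialize_map₁_reduce E.proj x).symm.trans hys⟩

variable {hI l}

/-- The cocycles of two presentations are cohomologous. -/
theorem IsCocycle.exists_sub_eq (h𝒢 : 𝒢.IsReductive) {X Y : p.LiftedPresentation E Z}
    {ψ χ : p.syzygy ⟶ quotientObj P I hI} (hψ : X.IsCocycle hI l ψ) (hχ : Y.IsCocycle hI l χ) :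
    ∃ φ, p.syzygyι ≫ φ = χ - ψ := by
  -- The difference of the two maps `u` has values in `Z` and vanishes modulo `𝔪_A`. By flatness it
  -- lies in `𝔪_A im u`, so it is `u ∘ a` over `A` for some `a` vanishing modulo the maximal ideal
  -- of `A'`.
  let t : p.F₁ (P.baseChange E.total) →ₗ[k] self (P.baseChange E.base) :=
    (lin X.u).restrictScalars k ∘ₗ p.map₁ (P.reduce E.proj)
  obtain ⟨a, haS, ha⟩ := exists_lift_of_gen (rational_subrep _ p.N₁) h𝒢 (P.reduce E.proj)
    (M := p.F₁ (P.baseChange E.total)) (M' := self (P.baseChange E.base))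
    (RingHom.ker (P.specialize E.total) • ⊤)
    (fun g m hm => by
      have h1 := (p.map₁_eq_zero_iff (specialize_surjective E.total) m).2
        hm
      refine (p.map₁_eq_zero_iff (specialize_surjective E.total) _).1 ?_
      exact (freeMap_act _ _ (specialize_act _) g m).trans
        ((congrArg _ h1).trans (map_zero _)))
    t (fun r m => (congrArg (lin X.u) (freeMap_smul _ _ r m)).trans ((lin X.u).map_smul _ _))
    (fun g m => (congrArg (lin X.u) (freeMap_act _ _ (reduce_act _) g m)).trans
      (lin_comm X.u g _)) (Y.u - X.u) fun n => by
        have h1 : lin (Y.u - X.u) (p.gen₁ _ n) ∈ LinearMap.range (lin X.u) := by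
          rw [lin_sub, LinearMap.sub_apply]
          refine sub_mem ?_ ⟨_, rfl⟩
          exact X.lifts.range_eq.ge (Y.lifts.range_eq.le ⟨_, rfl⟩)
        have h2 : P.specialize E.base (lin (Y.u - X.u) (p.gen₁ _ n)) = 0 := by
          have h3 := (X.lifts.specialize_u (p.gen₁ _ n)).trans
            (Y.lifts.specialize_u (p.gen₁ _ n)).symm
          exact (map_sub (P.specialize E.base) _ _).trans (sub_eq_zero.2 h3.symm)
        have h3 : lin (Y.u - X.u) (p.gen₁ _ n) ∈
            RingHom.ker (P.specialize E.base) • LinearMap.range (lin X.u) :=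
          X.lifts.range_inf_le ⟨h1, h2⟩
        rw [← Submodule.map_top, ← Submodule.map_smul''] at h3
        obtain ⟨y, hy, hyn⟩ := h3
        obtain ⟨m, rfl⟩ := p.map₁_surjective E.reduce_surjective y
        refine ⟨m, ?_, hyn⟩
        have h4 := (p.map₁_eq_zero_iff
          (specialize_surjective E.base) _).2 hy
        exact (p.map₁_eq_zero_iff (specialize_surjective E.total) _).1
          ((p.specialize_map₁_reduce E.proj m).symm.trans h4)
  let a : p.F₁ (P.baseChange E.total) ⟶ p.F₁ (P.baseChange E.total) := a
  have haS' (x : p.F₁ (P.baseChange E.total)) : p.map₁ (P.specialize E.total) (lin a x) = 0 :=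
    (p.map₁_eq_zero_iff (specialize_surjective E.total) _).2 (haS x)
  let α : p.F₁ (P.baseChange E.total) ⟶ p.F₁ (P.baseChange E.total) := 𝟙 _ + a
  have hα (x) : lin α x = x + lin a x := rfl
  have hXα (x) : P.reduce E.proj (lin X.u' (lin α x)) = P.reduce E.proj (lin Y.u' x) := by
    rw [X.reduce_u', Y.reduce_u', hα, map_add, map_add]
    exact (congrArg (lin X.u (p.map₁ (P.reduce E.proj) x) + ·) (ha x)).trans
      (add_sub_cancel (lin X.u (p.map₁ (P.reduce E.proj) x)) _)
  -- After the substitution `α` the two maps agree modulo `J`, and the remaining difference is a map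
  -- on `P ⊗ N₁`. The maps `v` need no comparison, since cocycles may be evaluated on any lift of a
  -- syzygy.
  obtain ⟨c, hc⟩ := E.exists_coordHom l (rational_subrep _ p.N₁) (Y.u' - α ≫ X.u') fun x =>
    (map_sub (P.reduce E.proj) _ _).trans (sub_eq_zero.2 (hXα x).symm)
  refine ⟨c ≫ quotientProj P I hI, ?_⟩
  ext s
  obtain ⟨x, hx, hxs⟩ := Y.exists_lift_syzygy s
  have h1 := hχ.value_eq Y x hx s hxs.symm
  have h2 := hψ.value_eq X (lin α x) ((hXα x).trans hx) s (by
    rw [hα, map_add, haS', add_zero, hxs])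
  rw [lin_sub, LinearMap.sub_apply, ← h1, ← h2]
  have h3 : lin c (lin p.syzygyι s) =
      E.coordMap l P (lin Y.u' x) - E.coordMap l P (lin X.u' (lin α x)) :=
    (congrArg (lin c) hxs).symm.trans ((hc x).symm.trans (map_sub (E.coordMap l P) _ _))
  exact (congrArg (lin (quotientProj P I hI)) h3).trans (map_sub (lin (quotientProj P I hI)) _ _)

end LiftedPresentation

end EquivariantPresentation

namespace EqMod

lemma lin_sum_apply {P : GAlg 𝒢} {M N : EqMod P} {ι : Type*} (s : Finset ι) (f : ι → (M ⟶ N))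
    (m : M) : lin (∑ i ∈ s, f i) m = ∑ i ∈ s, lin (f i) m :=
  map_sum (evalAt N m) f s

end EqMod

/-! ### The obstruction class: existence, uniqueness, vanishing and naturality -/

namespace EquivariantPresentation

variable {P : GAlg 𝒢} {I : Ideal P} (p : EquivariantPresentation P I)
  (hI : ∀ g, ∀ x ∈ I, P.act g x ∈ I) (E : SmallExtension k)

/-- The obstruction relation in coordinates. -/
lemma obRel_iff {ι : Type*} [Fintype ι] (b : Module.Basis ι k E.ker)
    (Z : (deformationFunctor P I).obj E.base) (c : E.ker ⊗[k] ExtOne P I hI) :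
    p.ObRel hI E Z c ↔ ∃ (X : p.LiftedPresentation E Z.1)
      (z : E.ker ⊗[k] (p.syzygy ⟶ quotientObj P I hI)),
      (∀ i, X.IsCocycle hI (b.coord i) (tensorCoord (b.coord i) _ z)) ∧
        c = (p.connecting hI).lTensor E.ker z := by
  constructor
  · rintro ⟨u, v, u', v', z, h, hu', hv', ht, hc⟩
    refine ⟨⟨u, v, u', v', h, hu', hv'⟩, z, fun i n => ?_, hc⟩
    obtain ⟨t, ht, ht'⟩ := ht n
    have h1 := congrArg (E.coordMap (b.coord i) P) ht
    have h2 := (E.coordMap_kerTensor (b.coord i) t).symm.trans h1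
    have h3 := congrArg (tensorCoord (b.coord i) (quotientObj P I hI)) ht'
    have h4 : tensorCoord (b.coord i) (quotientObj P I hI) _ =
        lin (quotientProj P I hI) (tensorCoord (b.coord i) P t) :=
      tensorCoord_lTensor (b.coord i) ((lin (quotientProj P I hI)).restrictScalars k) t
    exact (congrArg (lin (quotientProj P I hI)) h2).symm.trans
      (h4.symm.trans (h3.trans (tensorCoord_lTensor _ _ z)))
  · rintro ⟨X, z, hz, hc⟩
    refine ⟨X.u, X.v, X.u', X.v', z, X.lifts, X.reduce_u', X.reduce_v', fun n => ?_, hc⟩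
    obtain ⟨t, ht⟩ := (E.reduce_eq_zero_iff _).1 (X.reduce_u'_v' (p.gen₂ _ n))
    refine ⟨t, ht, tensorCoord_ext b fun i => ?_⟩
    have h1 := (E.coordMap_kerTensor (b.coord i) t).symm.trans
      (congrArg (E.coordMap (b.coord i) P) ht)
    have h4 : tensorCoord (b.coord i) (quotientObj P I hI) _ =
        lin (quotientProj P I hI) (tensorCoord (b.coord i) P t) :=
      tensorCoord_lTensor (b.coord i) ((lin (quotientProj P I hI)).restrictScalars k) t
    exact h4.trans ((congrArg (lin (quotientProj P I hI)) h1).trans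
      ((hz i n).trans (tensorCoord_lTensor (b.coord i)
        (evalAt (quotientObj P I hI) (lin p.toSyzygy (p.gen₂ P n))) z).symm))

theorem exists_obRel (h𝒢 : 𝒢.IsReductive) (Z : (deformationFunctor P I).obj E.base) :
    ∃ c, p.ObRel hI E Z c := by
  obtain ⟨X⟩ := p.exists_liftedPresentation E h𝒢 Z.2
  let b := Module.finBasis k E.ker
  choose ψ hψ using fun i => X.exists_isCocycle hI (b.coord i)
  obtain ⟨z, hz⟩ := exists_tensorCoord_eq b ψ
  exact ⟨_, (p.obRel_iff hI E b Z _).2 ⟨X, z, fun i => (hz i).symm ▸ hψ i, rfl⟩⟩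

variable {p hI E}

/-- In each coordinate of `J` the two cocycles differ by a restriction from `P ⊗ N₁`, which the
connecting map kills. -/
theorem ObRel.unique (h𝒢 : 𝒢.IsReductive) {Z : (deformationFunctor P I).obj E.base}
    {c d : E.ker ⊗[k] ExtOne P I hI} (hc : p.ObRel hI E Z c) (hd : p.ObRel hI E Z d) : c = d := by
  let b := Module.finBasis k E.ker
  obtain ⟨X, z, hz, rfl⟩ := (p.obRel_iff hI E b Z c).1 hc
  obtain ⟨Y, w, hw, rfl⟩ := (p.obRel_iff hI E b Z d).1 hd
  refine tensorCoord_ext b fun i => ?_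
  rw [tensorCoord_lTensor, tensorCoord_lTensor]
  have h := (p.connecting_eq_zero_iff hI _).2 ((hz i).exists_sub_eq h𝒢 (hw i))
  rw [map_sub, sub_eq_zero] at h
  exact h.symm

variable (p hI E)

/-- Deformations over `A'` have vanishing obstruction. -/
theorem obRel_zero_of_lift (h𝒢 : 𝒢.IsReductive) (Z : (deformationFunctor P I).obj E.total) :
    p.ObRel hI E ((deformationFunctor P I).map E.proj Z) 0 := by
  obtain ⟨u', v', h⟩ := p.exists_lifts h𝒢 Z.2
  obtain ⟨u, hu⟩ := exists_extendScalars (rational_subrep _ p.N₁) (P.reduce E.proj)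
    (M := self (P.baseChange E.total)) (M' := self (P.baseChange E.base))
    (selfMap (P.reduce E.proj)) (selfMap_smul _) (reduce_act _) u'
  obtain ⟨v, hv⟩ := exists_extendScalars (rational_subrep _ p.N₂) (P.reduce E.proj)
    (M := p.F₁ (P.baseChange E.total)) (M' := p.F₁ (P.baseChange E.base))
    (p.map₁ (P.reduce E.proj)) (freeMap_smul _ _) (freeMap_act _ _ (reduce_act _)) v'
  -- A presentation of the lifted deformation satisfies `u' v' = 0` exactly, so the zero cocycle
  -- serves for its reduction.
  refine ⟨u, v, u', v', 0, h.baseChange E.proj hu hv, hu, hv, fun n => ⟨0, ?_, ?_⟩, ?_⟩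
  · exact (map_zero (E.kerTensor P)).trans (h.comp_eq_zero (p.gen₂ _ n)).symm
  · exact (map_zero (((lin (quotientProj P I hI)).restrictScalars k).lTensor E.ker)).trans
      (map_zero _).symm
  · rw [map_zero]

/-- Deformations with vanishing obstruction lift to `A'`. -/
theorem exists_lift_of_obRel_zero (h𝒢 : 𝒢.IsReductive) {Z : (deformationFunctor P I).obj E.base}
    (h : p.ObRel hI E Z 0) : ∃ Y, (deformationFunctor P I).map E.proj Y = Z := by
  let b := Module.finBasis k E.ker
  obtain ⟨X, z, hz, hc⟩ := (p.obRel_iff hI E b Z 0).1 h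
  -- Each coordinate of the cocycle has class zero, so it extends to `P ⊗ N₁`; the extension lifts
  -- to a map into `P`.
  have h1 (i) : ∃ C : p.F₁ P ⟶ self P,
      p.syzygyι ≫ C ≫ quotientProj P I hI = tensorCoord (b.coord i) _ z := by
    have h2 := congrArg (tensorCoord (b.coord i) _) hc
    rw [tensorCoord_lTensor, map_zero] at h2
    obtain ⟨φ, hφ⟩ := (p.connecting_eq_zero_iff hI _).1 h2.symm
    obtain ⟨C, rfl⟩ := p.exists_lift_quotientProj₁ hI h𝒢 φ
    exact ⟨C, hφ⟩
  choose C hC using h1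
  let D (i) : p.F₁ (P.baseChange E.total) →ₗ[k] P :=
    (lin (C i)).restrictScalars k ∘ₗ p.map₁ (P.specialize E.total)
  have h2 (i) : ∃ B : p.F₁ (P.baseChange E.total) ⟶ self (P.baseChange E.total),
      ∀ x, lin B x = P.pure (b i : E.total) (D i x) :=
    E.exists_pureHom (rational_subrep _ p.N₁) (b i) (C i)
  choose B hB using h2
  -- Subtracting `∑ b i ⊗ C i` leaves the reduction to `A` unchanged and moves the values on lifted
  -- syzygies into `J ⊗ I`.
  let u'' : p.F₁ (P.baseChange E.total) ⟶ self (P.baseChange E.total) := X.u' - ∑ i, B i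
  let U (x : p.F₁ (P.baseChange E.total)) : P.baseChange E.total := lin X.u' x
  let S (x : p.F₁ (P.baseChange E.total)) : P.baseChange E.total :=
    ∑ i, P.pure (b i : E.total) (D i x)
  have hu'' (x) : lin u'' x = U x - S x := by
    refine congrArg (U x - ·) ?_
    exact (lin_sum_apply _ _ _).trans (Finset.sum_congr rfl fun i _ => hB i x)
  have hred (i) (q : P) : P.reduce E.proj (P.pure (b i : E.total) q) = 0 :=
    (E.reduce_eq_zero_iff _).2 ⟨b i ⊗ₜ q, rfl⟩
  have hspec (i) (q : P) : P.specialize E.total (P.pure (b i : E.total) q) = 0 := by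
    rw [specialize_pure, E.aug_eq_zero (b i).2, map_zero, zero_mul]
  have hur (x) : P.reduce E.proj (lin u'' x) = P.reduce E.proj (lin X.u' x) := by
    refine (congrArg (P.reduce E.proj) (hu'' x)).trans ((map_sub _ _ _).trans ?_)
    simp only [S, map_sum, hred, Finset.sum_const_zero, sub_zero]
    rfl
  have hus (x) : P.specialize E.total (lin u'' x) = lin p.u₀ (p.map₁ (P.specialize E.total) x) := by
    refine (congrArg (P.specialize E.total) (hu'' x)).trans ((map_sub _ _ _).trans ?_)
    simp only [S, map_sum, hspec, Finset.sum_const_zero, sub_zero]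
    exact X.specialize_u' x
  have hK (y : p.F₁ P) (hy : lin p.u₀ y = 0) :
      ∃ x, lin u'' x = 0 ∧ p.map₁ (P.specialize E.total) x = y := by
    obtain ⟨x, hx, hxy⟩ := X.exists_lift_syzygy ⟨y, hy⟩
    have h2 (i) : ∃ w, lin p.u₀ (p.map₁ (P.specialize E.total) w) =
        E.coordMap (b.coord i) P (lin u'' x) := by
      have h3 : E.coordMap (b.coord i) P (S x) = D i x := by
        simp only [S, map_sum, SmallExtension.coordMap_pure_ker, Module.Basis.coord_apply,
          Module.Basis.repr_self, Finsupp.single_apply, ite_smul, one_smul, zero_smul,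
          Finset.sum_ite_eq', Finset.mem_univ, if_true]
      have h4 := (hz i).value_eq X x hx ⟨y, hy⟩ hxy.symm
      have h5 := congrArg (fun a => lin a (⟨y, hy⟩ : LinearMap.ker (lin p.u₀))) (hC i)
      have h6 : lin (quotientProj P I hI) (D i x) =
        lin (quotientProj P I hI) (E.coordMap (b.coord i) P (lin X.u' x)) :=
        (congrArg (fun a => lin (quotientProj P I hI) (lin (C i) a)) hxy).trans (h5.trans h4.symm)
      have h7 : E.coordMap (b.coord i) P (lin u'' x) ∈ I := by
        rw [← quotientProj_eq_zero_iff hI]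
        have h8 := (congrArg (E.coordMap (b.coord i) P) (hu'' x)).trans (map_sub _ _ _)
        rw [h3] at h8
        exact (congrArg (lin (quotientProj P I hI)) h8).trans
          ((map_sub (lin (quotientProj P I hI)) _ _).trans (sub_eq_zero.2 h6.symm))
      obtain ⟨w, hw⟩ := (p.mem_ideal_iff _).1 h7
      obtain ⟨w, rfl⟩ := p.map₁_surjective (specialize_surjective E.total) w
      exact ⟨w, hw⟩
    choose w hw using h2
    -- The coordinates of `u'' x` are `u₀` of the reductions of the `w i`, so `u'' x = u'' (∑ (b i ⊗
    -- 1) • w i)`. Subtracting this sum gives an exact relation with the same reduction, as `b i`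
    -- lies in the maximal ideal.
    refine ⟨x - ∑ i, P.pure (b i : E.total) 1 • w i, ?_, ?_⟩
    · have h3 (i) : lin u'' (P.pure (b i : E.total) 1 • w i) =
          P.pure (b i : E.total) (E.coordMap (b.coord i) P (lin u'' x)) := by
        let y : P.baseChange E.total := lin u'' (w i)
        have h4 : lin u'' (P.pure (b i : E.total) 1 • w i) = y * P.pure (b i : E.total) 1 :=
          ((lin u'').map_smul _ _).trans (mul_comm _ y)
        rw [h4, E.mul_pure y (b i).2, mul_one, ← hw i]
        exact congrArg _ (hus (w i))
      rw [map_sub, map_sum, Finset.sum_congr rfl fun i _ => h3 i, sub_eq_zero]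
      exact E.eq_sum_pure_coordMap b ((hur x).trans hx)
    · rw [map_sub, map_sum, hxy]
      simp only [map₁_smul, hspec, zero_smul, Finset.sum_const_zero, sub_zero]
      rfl
  refine ⟨⟨LinearMap.range (lin u''), isDeformation_range _ p.range_eq hus hK⟩, Subtype.ext ?_⟩
  change Ideal.map (P.reduce E.proj) (LinearMap.range (lin u'')) = Z.1
  have hred' (x) : P.reduce E.proj (lin u'' x) = lin X.u (p.map₁ (P.reduce E.proj) x) :=
    (hur x).trans (X.reduce_u' x)
  apply le_antisymm
  · refine Ideal.map_le_iff_le_comap.2 ?_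
    rintro _ ⟨x, rfl⟩
    exact X.lifts.range_eq.le ⟨_, (hred' x).symm⟩
  · intro y hy
    obtain ⟨w, rfl⟩ := X.lifts.range_eq.ge hy
    obtain ⟨x, rfl⟩ := p.map₁_surjective E.reduce_surjective w
    have h2 := Ideal.mem_map_of_mem (P.reduce E.proj)
      (show lin u'' x ∈ LinearMap.range (lin u'') from ⟨x, rfl⟩)
    exact hred' x ▸ h2

variable {p hI E}

lemma reduce_comm {E' : SmallExtension k} (f : E.Hom E') (x : P.baseChange E.total) :
    P.reduce E'.proj (P.reduce f.onTotal x) = P.reduce f.onBase (P.reduce E.proj x) := by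
  have h (a : E.total) : Art.alg E'.proj (Art.alg f.onTotal a) =
      Art.alg f.onBase (Art.alg E.proj a) :=
    congrArg (fun φ => Art.alg φ a) f.comm.symm
  induction x using baseChange_induction with
  | pure a q => exact congrArg (P.pure · q) (h a)
  | add x y hx hy => rw [map_add, map_add, map_add, map_add, hx, hy]

lemma map₁_reduce_comm {E' : SmallExtension k} (f : E.Hom E') (x : p.F₁ (P.baseChange E.total)) :
    p.map₁ (P.reduce E'.proj) (p.map₁ (P.reduce f.onTotal) x) =
      p.map₁ (P.reduce f.onBase) (p.map₁ (P.reduce E.proj) x) := by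
  have h : (P.reduce E'.proj).comp (P.reduce f.onTotal) =
      (P.reduce f.onBase).comp (P.reduce E.proj) := AlgHom.ext (reduce_comm f)
  exact (freeMap_freeMap _ _ _ x).trans ((congrArg (fun φ => p.map₁ φ x) h).trans
    (freeMap_freeMap (rational_subrep _ p.N₁) _ _ x).symm)

/-- The obstruction relation is natural in the small extension. -/
theorem ObRel.natural {Z : (deformationFunctor P I).obj E.base} {c : E.ker ⊗[k] ExtOne P I hI}
    (h : p.ObRel hI E Z c) {E' : SmallExtension k} (f : E.Hom E') :
    p.ObRel hI E' ((deformationFunctor P I).map f.onBase Z)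
      (f.kerMap.rTensor (ExtOne P I hI) c) := by
  obtain ⟨u, v, u', v', z, h, hu', hv', ht, rfl⟩ := h
  have hext₁ {A B : Art k} (g : A ⟶ B) (w : p.F₁ (P.baseChange A) ⟶ self (P.baseChange A)) :
      ∃ w' : p.F₁ (P.baseChange B) ⟶ self (P.baseChange B), ∀ x,
        P.reduce g (lin w x) = lin w' (p.map₁ (P.reduce g) x) :=
    exists_extendScalars (rational_subrep _ p.N₁) (P.reduce g)
      (M := self (P.baseChange A)) (M' := self (P.baseChange B))
      (selfMap (P.reduce g)) (selfMap_smul _) (reduce_act _) w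
  have hext₂ {A B : Art k} (g : A ⟶ B) (w : p.F₂ (P.baseChange A) ⟶ p.F₁ (P.baseChange A)) :
      ∃ w' : p.F₂ (P.baseChange B) ⟶ p.F₁ (P.baseChange B), ∀ x,
        p.map₁ (P.reduce g) (lin w x) = lin w' (p.map₂ (P.reduce g) x) :=
    exists_extendScalars (rational_subrep _ p.N₂) (P.reduce g)
      (M := p.F₁ (P.baseChange A)) (M' := p.F₁ (P.baseChange B))
      (p.map₁ (P.reduce g)) (freeMap_smul _ _) (freeMap_act _ _ (reduce_act _)) w
  have hg₁ {A B : Art k} (g : A ⟶ B) (n) : p.map₁ (P.reduce g) (p.gen₁ _ n) = p.gen₁ _ n :=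
    freeMap_gen _ _ n
  have hg₂ {A B : Art k} (g : A ⟶ B) (n) : p.map₂ (P.reduce g) (p.gen₂ _ n) = p.gen₂ _ n :=
    freeMap_gen _ _ n
  -- All the data over the second extension are extensions of scalars of those over the first;
  -- squares over the two projections are checked on generators.
  obtain ⟨uB, huB⟩ := hext₁ f.onBase u
  obtain ⟨vB, hvB⟩ := hext₂ f.onBase v
  obtain ⟨uT, huT⟩ := hext₁ f.onTotal u'
  obtain ⟨vT, hvT⟩ := hext₂ f.onTotal v'
  refine ⟨uB, vB, uT, vT, f.kerMap.rTensor _ z, h.baseChange f.onBase huB hvB, ?_, ?_,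
    fun n => ?_, ?_⟩
  · refine square_of_gen (rational_subrep _ p.N₁) (P.reduce E'.proj) (selfMap (P.reduce E'.proj))
      (selfMap_smul _) uT uB fun n => ?_
    have h1 := congrArg (P.reduce E'.proj) ((huT _).trans (congrArg (lin uT) (hg₁ _ n)))
    have h2 := congrArg (P.reduce f.onBase) ((hu' _).trans (congrArg (lin u) (hg₁ _ n)))
    exact h1.symm.trans ((reduce_comm f _).trans (h2.trans ((huB _).trans
      (congrArg (lin uB) (hg₁ _ n)))))
  · refine square_of_gen (rational_subrep _ p.N₂) (P.reduce E'.proj) (p.map₁ (P.reduce E'.proj))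
      (freeMap_smul _ _) vT vB fun n => ?_
    have h1 := congrArg (p.map₁ (P.reduce E'.proj)) ((hvT _).trans (congrArg (lin vT) (hg₂ _ n)))
    have h2 := congrArg (p.map₁ (P.reduce f.onBase)) ((hv' _).trans (congrArg (lin v) (hg₂ _ n)))
    exact h1.symm.trans ((map₁_reduce_comm f _).trans (h2.trans ((hvB _).trans
      (congrArg (lin vB) (hg₂ _ n)))))
  · obtain ⟨t, ht, ht'⟩ := ht n
    refine ⟨f.kerMap.rTensor P t, ?_, ?_⟩
    · refine (E.kerTensor_kerMap f t).trans ((congrArg (P.reduce f.onTotal) ht).trans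
        ((huT _).trans ?_))
      exact congrArg (lin uT) ((hvT _).trans (congrArg (lin vT) (hg₂ _ n)))
    · exact (rTensor_lTensor_comm f.kerMap ((lin (quotientProj P I hI)).restrictScalars k) t).symm.trans
        ((congrArg (f.kerMap.rTensor _) ht').trans (rTensor_lTensor_comm _ _ z))
  · exact rTensor_lTensor_comm _ _ z

end EquivariantPresentation

end EquivariantDeformations

/-! ### The obstruction theory with values in `N^G` -/

theorem corollary3p10 {k G : Type u} [Field k] [IsAlgClosed k] [CharZero k] [Group G]
    (𝒢 : AlgGroup k G) (h𝒢 : 𝒢.IsReductive)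
    (P : GAlg 𝒢) (hP : Algebra.FiniteType k P)
    (I : Ideal P) (hI : ∀ g, ∀ x ∈ I, P.act g x ∈ I)
    (hX : ∀ (M : Type u) [AddCommGroup M] [Module k M] (σ : Representation k G M),
      𝒢.IsRational σ → σ.IsIrreducible →
        Module.Finite k (σ.IntertwiningMap (quotientObj P I hI).ρ))
    (p : EquivariantPresentation P I) :
    Module.Finite k (ExtOne P I hI) ∧ Module.Finite k p.NG ∧
    ∃ ι : ExtOne P I hI →ₗ[k] p.NG, Function.Injective ι ∧
      (∀ (ψ : p.syzygy ⟶ quotientObj P I hI) (C : p.F₂ P ⟶ EqMod.self P),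
        C ≫ quotientProj P I hI = p.toSyzygy ≫ ψ →
          ι (p.connecting hI ψ) = (LinearMap.range p.μ).mkQ C) ∧
      ∃ ob : ∀ E : SmallExtension k,
          (deformationFunctor P I).obj E.base → E.ker ⊗[k] ExtOne P I hI,
        (∀ E Z c, p.ObRel hI E Z c ↔ c = ob E Z) ∧
        IsObstructionTheory (deformationFunctor P I) p.NG
          (fun E Z => ι.lTensor E.ker (ob E Z)) := by
  obtain ⟨ι, hι, hιC⟩ := p.exists_extOne_embedding hI h𝒢
  have hfin := p.finite_NG hI h𝒢 hX
  refine ⟨p.finite_extOne hI h𝒢 hX, hfin, ι, hι, hιC, ?_⟩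
  choose ob hob using fun E Z => p.exists_obRel hI E h𝒢 Z
  have hiff (E Z c) : p.ObRel hI E Z c ↔ c = ob E Z :=
    ⟨fun h => h.unique h𝒢 (hob E Z), fun h => h ▸ hob E Z⟩
  refine ⟨ob, hiff, hfin, fun E Z => ?_, fun E E' f Z => ?_⟩
  -- `J` is flat over `k`, so `id_J ⊗ ι` is injective and vanishing may be tested before applying
  -- it.
  · have h1 : ι.lTensor E.ker (ob E Z) = 0 ↔ 0 = ob E Z := by
      rw [map_eq_zero_iff _ (Module.Flat.lTensor_preserves_injective_linearMap ι hι), eq_comm]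
    rw [h1, ← hiff]
    refine ⟨p.exists_lift_of_obRel_zero hI E h𝒢, ?_⟩
    rintro ⟨Y, rfl⟩
    exact p.obRel_zero_of_lift hI E h𝒢 Y
  · rw [← (hiff E' _ _).1 ((hob E Z).natural f), rTensor_lTensor_comm]
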